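/- Let $h\ge 1$, $0<\varepsilon<\frac{1}{2h+2h^2}$, and let $i\ge 2$ be an integer. Let $L=(q_1,\dots,q_n)$ be a list of squares, each with a positive side length and a nonnegative profit, such that every square is either \emph{large}, i.e. has side length at least $\varepsilon^{6^{i-1}}$, or \emph{small}, i.e. has side length at most $\varepsilon^{6^{i}}$. A \emph{packing} of a sublist of $L$ places its squares, axis-parallel and with pairwise disjoint interiors, in the rectangular bin $[0,1]\times[0,h]$; its profit is the sum of the profits of the packed squares. Let $OPT(L)$ be the maximum profit of a packing. Some of the squares of a packing are placed by \emph{corner packing} if they can be ordered so that, when they are placed in the bin one after another in this order, each of them has one of its corners at a vertex, with interior angle $90^\circ$, of the rectilinear polygons formed by the part of the bin left uncovered by the squares before it (at a point where two polygons, or two parts of one polygon, touch, the interior angle is measured on each side separately). Let $OPT(L,*)$ be the maximum profit of a packing all of whose large squares are placed by corner packing. Let $L_{opt}$ be a sublist of $L$ that has a packing and has total profit $OPT(L)$, and let $m$ be the number of large squares in $L_{opt}$. If $m\le 4$, then $$(1-\varepsilon)\,OPT(L)\le OPT(L,*).$$ -/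

import Mathlib

noncomputable section

namespace SquarePacking

/-- The closed axis-parallel square with side length `a` and lower left corner `z`. -/
def square (z : ℝ × ℝ) (a : ℝ) : Set (ℝ × ℝ) :=
  Set.Icc z.1 (z.1 + a) ×ˢ Set.Icc z.2 (z.2 + a)

/-- The rectangular bin `(1, h)` of width `1` and height `h`. -/
def bin (h : ℝ) : Set (ℝ × ℝ) :=
  Set.Icc 0 1 ×ˢ Set.Icc 0 h

/-- The items in `S` are packed into the bin `(1, h)`, item `j` having its lower left corner at
`pos j`: every square lies in the bin, and no two of them overlap (they may touch). -/
def IsPacking {n : ℕ} (h : ℝ) (side : Fin n → ℝ) (S : Finset (Fin n))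
    (pos : Fin n → ℝ × ℝ) : Prop :=
  (∀ j ∈ S, square (pos j) (side j) ⊆ bin h) ∧
  ∀ j ∈ S, ∀ k ∈ S, j ≠ k →
    Disjoint (interior (square (pos j) (side j))) (interior (square (pos k) (side k)))

/-- The total profit of the items in `S`. -/
def totalProfit {n : ℕ} (profit : Fin n → ℝ) (S : Finset (Fin n)) : ℝ :=
  ∑ j ∈ S, profit j

/-- `OPT(L)`: the largest total profit of items that can be packed into the bin. -/
def opt {n : ℕ} (h : ℝ) (side profit : Fin n → ℝ) : ℝ :=
  sSup {v | ∃ S pos, IsPacking h side S pos ∧ v = totalProfit profit S}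

/-- `L_opt`: a sublist of the items that can be packed and has the optimal profit. -/
def IsOptimal {n : ℕ} (h : ℝ) (side profit : Fin n → ℝ) (S : Finset (Fin n)) : Prop :=
  (∃ pos, IsPacking h side S pos) ∧ totalProfit profit S = opt h side profit

/-- The space of the bin left uncovered (a union of open rectilinear polygons) after the items in
the list `l` have been placed at the positions `pos`. -/
def uncovered {n : ℕ} (h : ℝ) (side : Fin n → ℝ) (pos : Fin n → ℝ × ℝ) (l : List (Fin n)) :
    Set (ℝ × ℝ) :=
  interior (bin h) \ {z | ∃ j ∈ l, z ∈ square (pos j) (side j)}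

/-- The open `r × r` box in the quadrant of `v` that is given by the signs `σ` and `τ`. -/
def quadrantBox (v : ℝ × ℝ) (σ τ r : ℝ) : Set (ℝ × ℝ) :=
  {z | σ * (z.1 - v.1) ∈ Set.Ioo 0 r ∧ τ * (z.2 - v.2) ∈ Set.Ioo 0 r}

/-- `v` is a vertex, with interior angle 90 degrees, of one of the rectilinear polygons that form
`U`: close to `v`, one quadrant belongs to `U` and neither of the two adjacent quadrants meets `U`.
(The opposite quadrant may belong to `U` where two polygons, or two parts of one polygon, touch at
`v`: the interior angle at `v` is then 90 degrees on either side.) -/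
def IsRightAngleVertex (U : Set (ℝ × ℝ)) (v : ℝ × ℝ) : Prop :=
  ∃ σ τ r : ℝ, (σ = 1 ∨ σ = -1) ∧ (τ = 1 ∨ τ = -1) ∧ 0 < r ∧
    quadrantBox v σ τ r ⊆ U ∧
    Disjoint (quadrantBox v (-σ) τ r) U ∧ Disjoint (quadrantBox v σ (-τ) r) U

/-- `v` is one of the four corners of the square with side length `a` and lower left corner `z`. -/
def IsCornerOf (v z : ℝ × ℝ) (a : ℝ) : Prop :=
  (v.1 = z.1 ∨ v.1 = z.1 + a) ∧ (v.2 = z.2 ∨ v.2 = z.2 + a)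

/-- The items of `l`, placed one after the other in this order, are placed by corner packing: each
one, when it is placed, has a corner at a vertex with interior angle 90 degrees of the polygons left
uncovered by those before it. -/
def IsCornerSequence {n : ℕ} (h : ℝ) (side : Fin n → ℝ) (pos : Fin n → ℝ × ℝ)
    (l : List (Fin n)) : Prop :=
  ∀ l₁ q l₂, l = l₁ ++ q :: l₂ →
    ∃ v, IsRightAngleVertex (uncovered h side pos l₁) v ∧ IsCornerOf v (pos q) (side q)

/-- A packing of `S` in which the items with side length at least `t` (the large ones) are
placed by corner packing, in some order. -/
def IsLargeCornerPacking {n : ℕ} (h : ℝ) (side : Fin n → ℝ) (t : ℝ) (S : Finset (Fin n))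
    (pos : Fin n → ℝ × ℝ) : Prop :=
  IsPacking h side S pos ∧
  ∃ l : List (Fin n), l.Nodup ∧ (∀ j, j ∈ l ↔ j ∈ S ∧ t ≤ side j) ∧
    IsCornerSequence h side pos l

/-- `OPT(L, *)`: the largest total profit of a packing whose large items are placed by corner
packing. -/
def cornerOpt {n : ℕ} (h : ℝ) (side profit : Fin n → ℝ) (t : ℝ) : ℝ :=
  sSup {v | ∃ S pos, IsLargeCornerPacking h side t S pos ∧ v = totalProfit profit S}

end SquarePacking

end

namespace SquarePacking

/-! ### Packings in rectangles and the repacking of small squares. -/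

variable {ι : Type*}

/-- The squares with lower left corners `z`, `w` and side lengths `a`, `b` do not overlap. -/
def Apart (z : ℝ × ℝ) (a : ℝ) (w : ℝ × ℝ) (b : ℝ) : Prop :=
  z.1 + a ≤ w.1 ∨ w.1 + b ≤ z.1 ∨ z.2 + a ≤ w.2 ∨ w.2 + b ≤ z.2

/-- The square with lower left corner `z` and side length `a` lies in `[x₀, x₁] × [y₀, y₁]`. -/
def Within (x₀ x₁ y₀ y₁ : ℝ) (z : ℝ × ℝ) (a : ℝ) : Prop :=
  x₀ ≤ z.1 ∧ z.1 + a ≤ x₁ ∧ y₀ ≤ z.2 ∧ z.2 + a ≤ y₁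

/-- The items in `S`, placed at `pos`, form a packing in the rectangle `[x₀, x₁] × [y₀, y₁]`. -/
def Packed (side : ι → ℝ) (S : Finset ι) (pos : ι → ℝ × ℝ) (x₀ x₁ y₀ y₁ : ℝ) : Prop :=
  (∀ j ∈ S, Within x₀ x₁ y₀ y₁ (pos j) (side j)) ∧
  ∀ j ∈ S, ∀ k ∈ S, j ≠ k → Apart (pos j) (side j) (pos k) (side k)

/-- Items are large (side length at least `t`) or small (at most `s`), and a large item is so long
that it can be cut into windows of length `2 * s`, the cheapest of which meets small items of at
most a fraction `δ` of the profit. -/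
structure Setting (side profit : ι → ℝ) (t s δ : ℝ) : Prop where
  side_pos : ∀ j, 0 < side j
  profit_nonneg : ∀ j, 0 ≤ profit j
  gap : ∀ j, t ≤ side j ∨ side j ≤ s
  s_pos : 0 < s
  s_lt : s < t
  windows : ∃ N : ℕ, 0 < N ∧ N * (2 * s) ≤ t ∧ 2 / N ≤ δ

variable {side profit : ι → ℝ} {t s δ : ℝ} {S T : Finset ι} {pos : ι → ℝ × ℝ}
  {x₀ x₁ y₀ y₁ : ℝ}

lemma Apart.symm {z w : ℝ × ℝ} {a b : ℝ} (h : Apart z a w b) : Apart w b z a := by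
  unfold Apart at *; tauto

lemma Packed.mono (h : Packed side S pos x₀ x₁ y₀ y₁) (hT : T ⊆ S) :
    Packed side T pos x₀ x₁ y₀ y₁ :=
  ⟨fun j hj => h.1 j (hT hj), fun j hj k hk => h.2 j (hT hj) k (hT hk)⟩

lemma Packed.translate (h : Packed side S pos x₀ x₁ y₀ y₁) (u v : ℝ) {x₀' x₁' y₀' y₁' : ℝ}
    (h₁ : x₀' ≤ x₀ + u) (h₂ : x₁ + u ≤ x₁') (h₃ : y₀' ≤ y₀ + v) (h₄ : y₁ + v ≤ y₁') :
    Packed side S (fun j => ((pos j).1 + u, (pos j).2 + v)) x₀' x₁' y₀' y₁' := by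
  refine ⟨fun j hj => ?_, fun j hj k hk hjk => ?_⟩
  · obtain ⟨a, b, c, d⟩ := h.1 j hj
    refine ⟨?_, ?_, ?_, ?_⟩ <;> simp only <;> linarith
  · rcases h.2 j hj k hk hjk with a | a | a | a
    · left; simp only; linarith
    · right; left; simp only; linarith
    · right; right; left; simp only; linarith
    · right; right; right; simp only; linarith

/-- Reflection in the diagonal: whatever is shown for horizontal slabs transfers to vertical ones.
-/
lemma Packed.swap (h : Packed side S pos x₀ x₁ y₀ y₁) :
    Packed side S (fun j => (pos j).swap) y₀ y₁ x₀ x₁ := by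
  refine ⟨fun j hj => ?_, fun j hj k hk hjk => ?_⟩
  · obtain ⟨a, b, c, d⟩ := h.1 j hj
    exact ⟨c, d, a, b⟩
  · have := h.2 j hj k hk hjk
    simp only [Apart, Prod.fst_swap, Prod.snd_swap] at *
    tauto

lemma Packed.flip (h : Packed side S pos x₀ x₁ y₀ y₁) :
    Packed side S (fun j => (x₀ + x₁ - (pos j).1 - side j, (pos j).2)) x₀ x₁ y₀ y₁ := by
  refine ⟨fun j hj => ?_, fun j hj k hk hjk => ?_⟩
  · obtain ⟨a, b, c, d⟩ := h.1 j hj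
    refine ⟨?_, ?_, c, d⟩ <;> simp only <;> linarith
  · rcases h.2 j hj k hk hjk with a | a | a | a
    · right; left; simp only; linarith
    · left; simp only; linarith
    · right; right; left; exact a
    · right; right; right; exact a

/-- A rectangle packed with items of side length at most `w` can be shortened by `w`: among `N`
windows of height `w`, remove the items that meet the cheapest one. -/
lemma Packed.compress (hprofit : ∀ j, 0 ≤ profit j) {w : ℝ} (hw : 0 < w)
    (h : Packed side S pos x₀ x₁ y₀ y₁) (hside : ∀ j ∈ S, side j ≤ w)
    {N : ℕ} (hN : 0 < N) (hNw : N * w ≤ y₁ - y₀) :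
    ∃ S' ⊆ S, ∃ pos', Packed side S' pos' x₀ x₁ y₀ (y₁ - w) ∧
      ∑ j ∈ S, profit j ≤ ∑ j ∈ S', profit j + 2 / N * ∑ j ∈ S, profit j := by
  classical
  -- The items that meet the open `k`-th window; those that only touch it can stay.
  set cut : ℕ → Finset ι := fun k => S.filter fun j =>
    y₀ + k * w < (pos j).2 + side j ∧ (pos j).2 < y₀ + (k + 1) * w with hcut
  have hsum : ∑ k ∈ Finset.range N, ∑ j ∈ cut k, profit j ≤ 2 * ∑ j ∈ S, profit j := by
    simp only [hcut, Finset.sum_filter]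
    rw [Finset.sum_comm, Finset.mul_sum]
    refine Finset.sum_le_sum fun j hj => ?_
    rw [← Finset.sum_filter, Finset.sum_const, nsmul_eq_mul]
    refine mul_le_mul_of_nonneg_right ?_ (hprofit j)
    -- An item of height at most `w` meets at most the window containing its lower edge and the next
    -- one.
    have hsub : (Finset.range N).filter (fun k : ℕ => y₀ + k * w < (pos j).2 + side j ∧
        (pos j).2 < y₀ + (k + 1) * w) ⊆
        {⌊((pos j).2 - y₀) / w⌋₊, ⌊((pos j).2 - y₀) / w⌋₊ + 1} := by
      intro k hk
      obtain ⟨-, h₁, h₂⟩ := Finset.mem_filter.1 hk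
      have hq : 0 ≤ ((pos j).2 - y₀) / w :=
        div_nonneg (by linarith [(h.1 j hj).2.2.1]) hw.le
      have e : ((pos j).2 - y₀) / w * w = (pos j).2 - y₀ := div_mul_cancel₀ _ hw.ne'
      have f₁ := Nat.floor_le hq
      have f₂ := Nat.lt_floor_add_one (((pos j).2 - y₀) / w)
      set q := ((pos j).2 - y₀) / w
      have hs := hside j hj
      have a₁ : q < k + 1 := by
        by_contra hc
        have := mul_le_mul_of_nonneg_right (not_lt.1 hc) hw.le
        linarith
      have a₂ : (k : ℝ) < q + 1 := by
        by_contra hc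
        have := mul_le_mul_of_nonneg_right (not_lt.1 hc) hw.le
        linarith
      have b₁ : (⌊q⌋₊ : ℝ) < k + 1 := by linarith
      have b₂ : (k : ℝ) < ⌊q⌋₊ + 2 := by linarith
      norm_cast at b₁ b₂
      simp only [Finset.mem_insert, Finset.mem_singleton]
      omega
    exact_mod_cast (Finset.card_le_card hsub).trans Finset.card_le_two
  obtain ⟨k, hk, hkle⟩ : ∃ k ∈ Finset.range N,
      ∑ j ∈ cut k, profit j ≤ 2 / N * ∑ j ∈ S, profit j := by
    refine Finset.exists_le_of_sum_le (by simpa using hN.ne') (hsum.trans ?_)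
    rw [Finset.sum_const, nsmul_eq_mul, Finset.card_range]
    have : (N : ℝ) ≠ 0 := by exact_mod_cast hN.ne'
    apply le_of_eq
    field_simp
  have hkN : ((k : ℝ) + 1) * w ≤ y₁ - y₀ := by
    have : ((k : ℝ) + 1) ≤ N := by exact_mod_cast Finset.mem_range.1 hk
    nlinarith
  have hkw : 0 ≤ (k : ℝ) * w := by positivity
  have hcases : ∀ j ∈ S \ cut k, (pos j).2 + side j ≤ y₀ + k * w ∨
      y₀ + (k + 1) * w ≤ (pos j).2 := by
    intro j hj
    simp only [hcut, Finset.mem_sdiff, Finset.mem_filter, not_and, not_lt] at hj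
    by_contra hc
    rw [not_or, not_le, not_le] at hc
    linarith [hj.2 hj.1 hc.1, hc.2]
  -- The survivors lie wholly below or wholly above the window; the upper ones drop by `w`.
  refine ⟨S \ cut k, Finset.sdiff_subset,
    fun j => ((pos j).1, if (pos j).2 + side j ≤ y₀ + k * w then (pos j).2 else (pos j).2 - w),
    ⟨fun j hj => ?_, fun j hj l hl hjl => ?_⟩, ?_⟩
  · have hW := h.1 j (Finset.sdiff_subset hj)
    obtain ⟨a, b, c, d⟩ := hW
    refine ⟨a, b, ?_, ?_⟩ <;> simp only <;> split_ifs with hif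
    · exact c
    · rcases hcases j hj with h' | h' <;> linarith
    · linarith
    · linarith
  · have hA := h.2 j (Finset.sdiff_subset hj) l (Finset.sdiff_subset hl) hjl
    have c₁ := hcases j hj
    have c₂ := hcases l hl
    rcases hA with a | a | a | a
    · exact Or.inl a
    · exact Or.inr (Or.inl a)
    · right; right
      simp only
      split_ifs <;> grind
    · right; right
      simp only
      split_ifs <;> grind
  · have := Finset.sum_sdiff (f := profit) (Finset.filter_subset _ S : cut k ⊆ S)
    linarith

/-- Small items in a strip around a large one (with a margin of `s` at both ends) can be repacked
along the large one itself. -/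
lemma Setting.compress (hS : Setting side profit t s δ) {m u : ℝ} (hm : t ≤ m)
    (h : Packed side S pos x₀ x₁ (u - s) (u + m + s)) (hsmall : ∀ j ∈ S, side j ≤ s) :
    ∃ S' ⊆ S, ∃ pos', Packed side S' pos' x₀ x₁ u (u + m) ∧
      ∑ j ∈ S, profit j ≤ ∑ j ∈ S', profit j + δ * ∑ j ∈ S, profit j := by
  obtain ⟨N, hN, hNs, hNδ⟩ := hS.windows
  have := hS.s_pos
  -- Both margins of length `s` are removed at once by one window of length `2 * s`; a shift by `s`
  -- then recentres the strip.
  obtain ⟨S', hS', pos', hp, hl⟩ := h.compress hS.profit_nonneg (w := 2 * s) (by linarith)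
    (fun j hj => by linarith [hsmall j hj]) hN (by linarith)
  refine ⟨S', hS', _, hp.translate 0 s (by linarith) (by linarith) (by linarith) (by linarith),
    hl.trans ?_⟩
  have : 0 ≤ ∑ j ∈ S, profit j := Finset.sum_nonneg fun j _ => hS.profit_nonneg j
  gcongr

lemma Setting.small (hS : Setting side profit t s δ) {j : ι} (hj : ¬ t ≤ side j) : side j ≤ s :=
  (hS.gap j).resolve_left hj

/-- A large item `M` whose horizontal slab meets no other large item can be separated: the small
items that meet the slab are repacked in a rectangle next to `M`, and the slab is cut out. -/
lemma Setting.exists_cut_slab [DecidableEq ι] (hS : Setting side profit t s δ)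
    (h : Packed side S pos x₀ x₁ y₀ y₁) {M : ι} (hM : M ∈ S) (hMt : t ≤ side M)
    (hsep : ∀ j ∈ S, t ≤ side j → j ≠ M →
      (pos j).2 + side j ≤ (pos M).2 ∨ (pos M).2 + side M ≤ (pos j).2) :
    ∃ T₁ pos₁ T₂ pos₂, T₁ ⊆ S.erase M ∧ T₂ ⊆ S.erase M ∧ Disjoint T₁ T₂ ∧
      (∀ j ∈ S, t ≤ side j → j ≠ M → j ∈ T₁) ∧
      Packed side T₁ pos₁ x₀ x₁ y₀ (y₁ - side M) ∧
      Packed side T₂ pos₂ 0 (x₁ - x₀ - side M) 0 (side M) ∧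
      ∑ j ∈ S, profit j ≤ profit M + ∑ j ∈ T₁, profit j + ∑ j ∈ T₂, profit j +
        δ * ∑ j ∈ S, profit j := by
  set T := (S.erase M).filter fun j =>
    (pos M).2 < (pos j).2 + side j ∧ (pos j).2 < (pos M).2 + side M with hT
  have hTS : T ⊆ S.erase M := Finset.filter_subset _ _
  have hTsmall : ∀ j ∈ T, side j ≤ s := by
    intro j hj
    obtain ⟨hjS, hj₁, hj₂⟩ := Finset.mem_filter.1 hj
    refine hS.small fun hjt => ?_
    rcases hsep j (Finset.mem_of_mem_erase hjS) hjt (Finset.ne_of_mem_erase hjS) with h' | h' <;>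
      linarith
  have hTx : ∀ j ∈ T, (pos j).1 + side j ≤ (pos M).1 ∨ (pos M).1 + side M ≤ (pos j).1 := by
    intro j hj
    obtain ⟨hjS, hj₁, hj₂⟩ := Finset.mem_filter.1 hj
    rcases h.2 j (Finset.mem_of_mem_erase hjS) M hM (Finset.ne_of_mem_erase hjS) with
      h' | h' | h' | h'
    · exact Or.inl h'
    · exact Or.inr h'
    · linarith
    · linarith
  have hMpos := hS.side_pos M
  obtain ⟨m₁, m₂, m₃, m₄⟩ := h.1 M hM
  -- Without `M`, the items of `T` on its right slide left by `side M` and close the gap.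
  have hcol : Packed side T (fun j => (if (pos j).1 + side j ≤ (pos M).1 then (pos j).1
      else (pos j).1 - side M, (pos j).2)) x₀ (x₁ - side M) ((pos M).2 - s)
      ((pos M).2 + side M + s) := by
    refine ⟨fun j hj => ?_, fun j hj k hk hjk => ?_⟩
    · obtain ⟨a, b, c, d⟩ := h.1 j (Finset.mem_of_mem_erase (hTS hj))
      have h₁ := hTx j hj
      have h₂ := hTsmall j hj
      obtain ⟨-, h₃, h₄⟩ := Finset.mem_filter.1 hj
      refine ⟨?_, ?_, ?_, ?_⟩ <;> simp only
      · split_ifs with hif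
        · exact a
        · rcases h₁ with h₁ | h₁ <;> linarith
      · split_ifs with hif <;> linarith
      · linarith
      · linarith
    · have hA := h.2 j (Finset.mem_of_mem_erase (hTS hj)) k (Finset.mem_of_mem_erase (hTS hk)) hjk
      have c₁ := hTx j hj
      have c₂ := hTx k hk
      rcases hA with a | a | a | a
      · rw [Apart]; simp only; split_ifs <;> grind
      · rw [Apart]; simp only; split_ifs <;> grind
      · exact Or.inr (Or.inr (Or.inl a))
      · exact Or.inr (Or.inr (Or.inr a))
  obtain ⟨T₂, hT₂, pos₂, hp₂, hl₂⟩ := hS.compress hMt hcol hTsmall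
  have hrest : ∀ j ∈ (S.erase M) \ T, (pos j).2 + side j ≤ (pos M).2 ∨
      (pos M).2 + side M ≤ (pos j).2 := by
    intro j hj
    simp only [hT, Finset.mem_sdiff, Finset.mem_filter, not_and, not_lt] at hj
    by_contra hc
    rw [not_or, not_le, not_le] at hc
    linarith [hj.2 hj.1 hc.1]
  refine ⟨(S.erase M) \ T, fun j => ((pos j).1, if (pos j).2 + side j ≤ (pos M).2 then (pos j).2
      else (pos j).2 - side M), T₂, _, Finset.sdiff_subset, hT₂.trans hTS,
      Finset.disjoint_of_subset_right hT₂ Finset.sdiff_disjoint, ?_, ⟨?_, ?_⟩,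
      hp₂.translate (-x₀) (-(pos M).2) (by linarith) (by linarith) (by linarith) (by linarith), ?_⟩
  · intro j hj hjt hjM
    refine Finset.mem_sdiff.2 ⟨Finset.mem_erase.2 ⟨hjM, hj⟩, fun hjT => ?_⟩
    linarith [hTsmall j hjT, hS.s_lt]
  · intro j hj
    obtain ⟨a, b, c, d⟩ := h.1 j (Finset.mem_of_mem_erase (Finset.sdiff_subset hj))
    refine ⟨a, b, ?_, ?_⟩ <;> simp only <;> split_ifs with hif
    · exact c
    · rcases hrest j hj with h' | h' <;> linarith
    · linarith
    · linarith
  · intro j hj k hk hjk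
    have hA := h.2 j (Finset.mem_of_mem_erase (Finset.sdiff_subset hj)) k
      (Finset.mem_of_mem_erase (Finset.sdiff_subset hk)) hjk
    have c₁ := hrest j hj
    have c₂ := hrest k hk
    rcases hA with a | a | a | a
    · exact Or.inl a
    · exact Or.inr (Or.inl a)
    · right; right; simp only; split_ifs <;> grind
    · right; right; simp only; split_ifs <;> grind
  · obtain ⟨N, hN, -, hNδ⟩ := hS.windows
    have hδ : 0 ≤ δ := le_trans (by positivity) hNδ
    have e₁ := Finset.sum_sdiff (f := profit) hTS
    have e₂ := Finset.add_sum_erase S profit hM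
    have hTle : ∑ j ∈ T, profit j ≤ ∑ j ∈ S, profit j :=
      Finset.sum_le_sum_of_subset_of_nonneg (hTS.trans (Finset.erase_subset _ _))
        fun j _ _ => hS.profit_nonneg j
    have := mul_le_mul_of_nonneg_left hTle hδ
    linarith

/-- A large item with no large item between it and the left wall can be moved to that wall. -/
lemma Setting.exists_move_left (hS : Setting side profit t s δ)
    (h : Packed side S pos x₀ x₁ y₀ y₁) {A : ι} (hA : A ∈ S) (hAt : t ≤ side A)
    (hfree : ∀ j ∈ S, t ≤ side j → j ≠ A → (pos j).1 + side j ≤ (pos A).1 →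
      (pos j).2 + side j ≤ (pos A).2 ∨ (pos A).2 + side A ≤ (pos j).2) :
    ∃ S' ⊆ S, ∃ pos', (∀ j ∈ S, t ≤ side j → j ∈ S') ∧ Packed side S' pos' x₀ x₁ y₀ y₁ ∧
      pos' A = (x₀, (pos A).2) ∧ (∀ j, t ≤ side j → j ≠ A → pos' j = pos j) ∧
      ∑ j ∈ S, profit j ≤ ∑ j ∈ S', profit j + δ * ∑ j ∈ S, profit j := by
  classical
  set T := (S.erase A).filter fun j => (pos j).1 + side j ≤ (pos A).1 ∧
    (pos A).2 < (pos j).2 + side j ∧ (pos j).2 < (pos A).2 + side A with hT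
  have hTS : T ⊆ S.erase A := Finset.filter_subset _ _
  have hTsmall : ∀ j ∈ T, side j ≤ s := by
    intro j hj
    obtain ⟨hjS, hj₀, hj₁, hj₂⟩ := Finset.mem_filter.1 hj
    refine hS.small fun hjt => ?_
    rcases hfree j (Finset.mem_of_mem_erase hjS) hjt (Finset.ne_of_mem_erase hjS) hj₀ with
      h' | h' <;> linarith
  obtain ⟨m₁, m₂, m₃, m₄⟩ := h.1 A hA
  have hTp : Packed side T pos x₀ (pos A).1 ((pos A).2 - s) ((pos A).2 + side A + s) := by
    refine ⟨fun j hj => ?_,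
      (h.mono (hTS.trans (Finset.erase_subset _ _))).2⟩
    obtain ⟨hjS, hj₀, hj₁, hj₂⟩ := Finset.mem_filter.1 hj
    have := hTsmall j hj
    exact ⟨(h.1 j (Finset.mem_of_mem_erase hjS)).1, hj₀, by linarith, by linarith⟩
  obtain ⟨T', hT', pos₂, hp₂, hl₂⟩ := hS.compress hAt hTp hTsmall
  have hrest : ∀ j ∈ (S.erase A) \ T, (pos A).1 + side A ≤ (pos j).1 ∨
      (pos j).2 + side j ≤ (pos A).2 ∨ (pos A).2 + side A ≤ (pos j).2 := by
    intro j hj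
    simp only [hT, Finset.mem_sdiff, Finset.mem_filter, not_and, not_lt] at hj
    by_contra hc
    rw [not_or, not_or, not_le, not_le, not_le] at hc
    rcases h.2 j (Finset.mem_of_mem_erase hj.1) A hA (Finset.ne_of_mem_erase hj.1) with
      h' | h' | h' | h'
    · linarith [hj.2 hj.1 h' hc.2.1]
    all_goals linarith
  have hAT' : A ∉ T' := fun hc => by simpa using hTS (hT' hc)
  have hS' : ∀ j ∈ S \ (T \ T'), j = A ∨ j ∈ T' ∨ (j ∈ (S.erase A) \ T ∧ j ∉ T' ∧ j ≠ A) := by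
    intro j hj
    simp only [Finset.mem_sdiff, Finset.mem_erase, not_and, not_not] at hj ⊢
    tauto
  have hpos := hS.side_pos
  -- The repacked items shift right by `side A`; together with `A` they stay in the part of its slab
  -- up to its former right edge, which all other items avoid.
  refine ⟨S \ (T \ T'), Finset.sdiff_subset, fun j => if j = A then (x₀, (pos A).2) else
    if j ∈ T' then ((pos₂ j).1 + side A, (pos₂ j).2) else pos j, ?_, ⟨?_, ?_⟩, by simp, ?_, ?_⟩
  · intro j hj hjt
    refine Finset.mem_sdiff.2 ⟨hj, fun hjT => ?_⟩
    linarith [hTsmall j (Finset.sdiff_subset hjT), hS.s_lt]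
  · intro j hj
    rcases hS' j hj with rfl | hjT | ⟨hjr, hjT, hjA⟩
    · simp only [if_true]
      refine ⟨le_rfl, ?_, m₃, m₄⟩
      simp only; linarith
    · have hjA : j ≠ A := fun hc => hAT' (hc ▸ hjT)
      simp only [if_neg hjA, if_pos hjT]
      obtain ⟨a, b, c, d⟩ := hp₂.1 j hjT
      have := hpos A
      refine ⟨?_, ?_, ?_, ?_⟩ <;> simp only <;> linarith
    · simp only [if_neg hjA, if_neg hjT]
      exact h.1 j (Finset.mem_of_mem_erase (Finset.sdiff_subset hjr))
  · have h₁ : ∀ j ∈ T', Apart (x₀, (pos A).2) (side A) ((pos₂ j).1 + side A, (pos₂ j).2)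
        (side j) := fun j hj => Or.inl (by simpa using (hp₂.1 j hj).1)
    have h₂ : ∀ j ∈ (S.erase A) \ T, Apart (x₀, (pos A).2) (side A) (pos j) (side j) := by
      intro j hj
      rcases hrest j hj with h' | h' | h'
      · left; simp only; linarith
      · right; right; right; exact h'
      · right; right; left; exact h'
    have h₃ : ∀ j ∈ T', ∀ k ∈ (S.erase A) \ T,
        Apart ((pos₂ j).1 + side A, (pos₂ j).2) (side j) (pos k) (side k) := by
      intro j hj k hk
      obtain ⟨a, b, c, d⟩ := hp₂.1 j hj
      rcases hrest k hk with h' | h' | h'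
      · left; simp only; linarith
      · right; right; right; simp only; linarith
      · right; right; left; simp only; linarith
    intro j hj k hk hjk
    have hne : ∀ l ∈ T', l ≠ A := fun l hl hc => hAT' (hc ▸ hl)
    rcases hS' j hj with rfl | hjT | ⟨hjr, hjT, hjA⟩ <;>
      rcases hS' k hk with rfl | hkT | ⟨hkr, hkT, hkA⟩
    · exact absurd rfl hjk
    · simpa only [if_true, if_neg (hne k hkT), if_pos hkT] using h₁ k hkT
    · simpa only [if_true, if_neg hkA, if_neg hkT] using h₂ k hkr
    · simpa only [if_true, if_neg (hne j hjT), if_pos hjT] using (h₁ j hjT).symm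
    · simp only [if_neg (hne j hjT), if_pos hjT, if_neg (hne k hkT), if_pos hkT]
      have := (hp₂.translate (side A) 0 le_rfl le_rfl le_rfl le_rfl).2 j hjT k hkT hjk
      simpa using this
    · simpa only [if_neg (hne j hjT), if_pos hjT, if_neg hkA, if_neg hkT] using h₃ j hjT k hkr
    · simpa only [if_true, if_neg hjA, if_neg hjT] using (h₂ j hjr).symm
    · simpa only [if_neg (hne k hkT), if_pos hkT, if_neg hjA, if_neg hjT]
        using (h₃ k hkT j hjr).symm
    · simp only [if_neg hjA, if_neg hjT, if_neg hkA, if_neg hkT]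
      exact h.2 j (Finset.sdiff_subset hj) k (Finset.sdiff_subset hk) hjk
  · intro j hjt hjA
    have hjT : j ∉ T' := fun hjT => by linarith [hTsmall j (hT' hjT), hS.s_lt]
    simp only [if_neg hjA, if_neg hjT]
  · obtain ⟨N, hN, -, hNδ⟩ := hS.windows
    have hδ : 0 ≤ δ := le_trans (by positivity) hNδ
    have e₁ := Finset.sum_sdiff (f := profit) (Finset.sdiff_subset.trans
      (hTS.trans (Finset.erase_subset _ _)) : T \ T' ⊆ S)
    have e₂ := Finset.sum_sdiff (f := profit) hT'
    have hTle : ∑ j ∈ T, profit j ≤ ∑ j ∈ S, profit j :=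
      Finset.sum_le_sum_of_subset_of_nonneg (hTS.trans (Finset.erase_subset _ _))
        fun j _ _ => hS.profit_nonneg j
    have := mul_le_mul_of_nonneg_left hTle hδ
    linarith

end SquarePacking

namespace SquarePacking

/-! ### Corner packing expressed by blocked quadrants. -/

variable {ι : Type*}

/-- The points near `x` on the side of `x` given by `σ` (`true` for above) lie in `[lo, hi]`. -/
def Beside : Bool → ℝ → ℝ → ℝ → Prop
  | true, x, lo, hi => lo ≤ x ∧ x < hi
  | false, x, lo, hi => lo < x ∧ x ≤ hi

/-- `B x y σ τ` says that near `(x, y)` the quadrant with signs `σ` and `τ` is blocked; here the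
square with lower left corner `z` and side length `a` is added to the blocked region. -/
def addBlocked (B : ℝ → ℝ → Bool → Bool → Prop) (z : ℝ × ℝ) (a : ℝ) (x y : ℝ) (σ τ : Bool) :
    Prop :=
  B x y σ τ ∨ Beside σ x z.1 (z.1 + a) ∧ Beside τ y z.2 (z.2 + a)

/-- One of the two ends of the interval `[x, x + a]`: the one from which the interval extends in
the direction `σ`. -/
def endpoint (σ : Bool) (x a : ℝ) : ℝ := if σ then x else x + a

/-- The square with lower left corner `z` and side length `a` has a corner next to which both
adjacent quadrants are blocked. -/
def CornerOK (B : ℝ → ℝ → Bool → Bool → Prop) (z : ℝ × ℝ) (a : ℝ) : Prop :=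
  ∃ σ τ : Bool, B (endpoint σ z.1 a) (endpoint τ z.2 a) (!σ) τ ∧
    B (endpoint σ z.1 a) (endpoint τ z.2 a) σ (!τ)

/-- The items of the list are placed by corner packing, if `B` describes the quadrants that are
blocked at the beginning. -/
def CornerSeq (side : ι → ℝ) (pos : ι → ℝ × ℝ) : (ℝ → ℝ → Bool → Bool → Prop) → List ι → Prop
  | _, [] => True
  | B, q :: l => CornerOK B (pos q) (side q) ∧ CornerSeq side pos (addBlocked B (pos q) (side q)) l

variable {side profit : ι → ℝ} {t s δ : ℝ} {S T : Finset ι} {pos pos' : ι → ℝ × ℝ}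
  {x₀ x₁ y₀ y₁ : ℝ} {B : ℝ → ℝ → Bool → Bool → Prop}

lemma addBlocked_swap (z : ℝ × ℝ) (a : ℝ) :
    addBlocked (fun x y σ τ => B y x τ σ) z.swap a =
      fun x y σ τ => addBlocked B z a y x τ σ := by
  funext x y σ τ
  simp only [addBlocked, Prod.fst_swap, Prod.snd_swap, and_comm]

lemma CornerOK.swap {z : ℝ × ℝ} {a : ℝ} (h : CornerOK B z a) :
    CornerOK (fun x y σ τ => B y x τ σ) z.swap a := by
  obtain ⟨σ, τ, h₁, h₂⟩ := h
  exact ⟨τ, σ, h₂, h₁⟩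

lemma CornerSeq.swap {l : List ι} : ∀ {B : ℝ → ℝ → Bool → Bool → Prop}, CornerSeq side pos B l →
    CornerSeq side (fun j => (pos j).swap) (fun x y σ τ => B y x τ σ) l := by
  induction l with
  | nil => intro B _; trivial
  | cons q l ih =>
    rintro B ⟨h₁, h₂⟩
    exact ⟨h₁.swap, by rw [addBlocked_swap]; exact ih h₂⟩

lemma CornerSeq.congr {l : List ι} (hl : ∀ j ∈ l, pos j = pos' j) :
    ∀ {B : ℝ → ℝ → Bool → Bool → Prop}, CornerSeq side pos B l → CornerSeq side pos' B l := by
  induction l with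
  | nil => intro B _; trivial
  | cons q l ih =>
    rintro B ⟨h₁, h₂⟩
    have hq := hl q (by simp)
    exact ⟨hq ▸ h₁, hq ▸ ih (fun j hj => hl j (by simp [hj])) h₂⟩

variable (side profit t δ) in
/-- Up to a loss of at most `k * δ` of the profit, the items in `S` can be packed in the rectangle
`[x₀, x₁] × [y₀, y₁]` with all the large ones placed by corner packing. -/
def Reach (B : ℝ → ℝ → Bool → Bool → Prop) (S : Finset ι) (x₀ x₁ y₀ y₁ : ℝ) (k : ℕ) : Prop :=
  ∃ S' ⊆ S, ∃ pos l, Packed side S' pos x₀ x₁ y₀ y₁ ∧ l.Nodup ∧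
    (∀ j, j ∈ l ↔ j ∈ S ∧ t ≤ side j) ∧ (∀ j ∈ l, j ∈ S') ∧ CornerSeq side pos B l ∧
    ∑ j ∈ S, profit j ≤ ∑ j ∈ S', profit j + k * δ * ∑ j ∈ S, profit j

lemma Reach.swap {k : ℕ} (h : Reach side profit t δ (fun x y σ τ => B y x τ σ) S y₀ y₁ x₀ x₁ k) :
    Reach side profit t δ B S x₀ x₁ y₀ y₁ k := by
  obtain ⟨S', hS', pos, l, hp, hl, hlS, hlS', hc, hle⟩ := h
  exact ⟨S', hS', _, l, hp.swap, hl, hlS, hlS', hc.swap, hle⟩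

lemma Setting.δ_nonneg (hS : Setting side profit t s δ) : 0 ≤ δ := by
  obtain ⟨N, hN, -, hNδ⟩ := hS.windows
  exact le_trans (by positivity) hNδ

lemma Setting.sum_nonneg (hS : Setting side profit t s δ) (S : Finset ι) :
    0 ≤ ∑ j ∈ S, profit j :=
  Finset.sum_nonneg fun j _ => hS.profit_nonneg j

lemma Reach.mono (hS : Setting side profit t s δ) {k k' : ℕ} (hk : k ≤ k')
    (h : Reach side profit t δ B S x₀ x₁ y₀ y₁ k) : Reach side profit t δ B S x₀ x₁ y₀ y₁ k' := by
  obtain ⟨S', hS', pos, l, hp, hl, hlS, hlS', hc, hle⟩ := h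
  refine ⟨S', hS', _, l, hp, hl, hlS, hlS', hc, hle.trans ?_⟩
  have := hS.sum_nonneg S
  have := hS.δ_nonneg
  gcongr

lemma reach_of_no_large
    (h : Packed side S pos x₀ x₁ y₀ y₁) (hcard : (S.filter fun j => t ≤ side j) = ∅) :
    Reach side profit t δ B S x₀ x₁ y₀ y₁ 0 := by
  refine ⟨S, subset_rfl, pos, [], h, List.nodup_nil, fun j => ?_, by simp, trivial, by simp⟩
  simpa using Finset.filter_eq_empty_iff.1 hcard (x := j)

/-- If any two of three objects are related by one of two symmetric relations, then one of them is
related to both others by the same relation. -/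
lemma exists_uniform_of_three {X Y : ι → ι → Prop} (hX : ∀ j k, X j k → X k j)
    (hY : ∀ j k, Y j k → Y k j) {P Q R : ι} (h₁ : X P Q ∨ Y P Q) (h₂ : X P R ∨ Y P R)
    (h₃ : X Q R ∨ Y Q R) :
    ∃ N, (N = P ∨ N = Q ∨ N = R) ∧ ((∀ j, (j = P ∨ j = Q ∨ j = R) → j ≠ N → X j N) ∨
      ∀ j, (j = P ∨ j = Q ∨ j = R) → j ≠ N → Y j N) := by
  have hP : ∀ Z : ι → ι → Prop, Z Q P → Z R P →
      ∀ j, (j = P ∨ j = Q ∨ j = R) → j ≠ P → Z j P := by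
    rintro Z a b j (rfl | rfl | rfl) hj
    exacts [absurd rfl hj, a, b]
  have hQ : ∀ Z : ι → ι → Prop, Z P Q → Z R Q →
      ∀ j, (j = P ∨ j = Q ∨ j = R) → j ≠ Q → Z j Q := by
    rintro Z a b j (rfl | rfl | rfl) hj
    exacts [a, absurd rfl hj, b]
  have hR : ∀ Z : ι → ι → Prop, Z P R → Z Q R →
      ∀ j, (j = P ∨ j = Q ∨ j = R) → j ≠ R → Z j R := by
    rintro Z a b j (rfl | rfl | rfl) hj
    exacts [a, b, absurd rfl hj]
  -- If `P` is related to `Q` and `R` differently, the relation between `Q` and `R` repeats one of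
  -- the two.
  rcases h₁ with h₁ | h₁ <;> rcases h₂ with h₂ | h₂
  · exact ⟨P, Or.inl rfl, Or.inl (hP _ (hX _ _ h₁) (hX _ _ h₂))⟩
  · rcases h₃ with h₃ | h₃
    · exact ⟨Q, Or.inr (Or.inl rfl), Or.inl (hQ _ h₁ (hX _ _ h₃))⟩
    · exact ⟨R, Or.inr (Or.inr rfl), Or.inr (hR _ h₂ h₃)⟩
  · rcases h₃ with h₃ | h₃
    · exact ⟨R, Or.inr (Or.inr rfl), Or.inl (hR _ h₂ h₃)⟩
    · exact ⟨Q, Or.inr (Or.inl rfl), Or.inr (hQ _ h₁ (hY _ _ h₃))⟩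
  · exact ⟨P, Or.inl rfl, Or.inr (hP _ (hY _ _ h₁) (hY _ _ h₂))⟩

/-! ### Cuts, and up to three large squares. -/

variable [DecidableEq ι]

/-- Three packings in rectangles that do not overlap, one of them with the single item `M`, form
a packing. -/
lemma Packed.glue {T₁ T₂ : Finset ι} {M : ι} {pos₁ pos₂ : ι → ℝ × ℝ} {z : ℝ × ℝ}
    {a₀ a₁ b₀ b₁ c₀ c₁ d₀ d₁ : ℝ}
    (h₁ : Packed side T₁ pos₁ a₀ a₁ b₀ b₁) (h₂ : Packed side T₂ pos₂ c₀ c₁ d₀ d₁)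
    (hz : Within x₀ x₁ y₀ y₁ z (side M))
    (ha₀ : x₀ ≤ a₀) (ha₁ : a₁ ≤ x₁) (hb₀ : y₀ ≤ b₀) (hb₁ : b₁ ≤ y₁)
    (hc₀ : x₀ ≤ c₀) (hc₁ : c₁ ≤ x₁) (hd₀ : y₀ ≤ d₀) (hd₁ : d₁ ≤ y₁)
    (hM₁ : M ∉ T₁) (hM₂ : M ∉ T₂) (hT : Disjoint T₁ T₂)
    (hz₁ : b₁ ≤ z.2 ∨ z.2 + side M ≤ b₀) (hz₂ : c₁ ≤ z.1 ∨ z.1 + side M ≤ c₀)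
    (h₁₂ : b₁ ≤ d₀ ∨ d₁ ≤ b₀) :
    Packed side (insert M (T₁ ∪ T₂))
      (fun j => if j = M then z else if j ∈ T₁ then pos₁ j else pos₂ j) x₀ x₁ y₀ y₁ := by
  have hne₁ : ∀ j ∈ T₁, j ≠ M := fun j hj hc => hM₁ (hc ▸ hj)
  have hne₂ : ∀ j ∈ T₂, j ≠ M := fun j hj hc => hM₂ (hc ▸ hj)
  have hn₂ : ∀ j ∈ T₂, j ∉ T₁ := fun j hj hc => Finset.disjoint_left.1 hT hc hj
  have k₁ : ∀ j ∈ T₁, Apart z (side M) (pos₁ j) (side j) := by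
    intro j hj
    obtain ⟨a, b, c, d⟩ := h₁.1 j hj
    rcases hz₁ with h | h
    · right; right; right; linarith
    · right; right; left; linarith
  have k₂ : ∀ j ∈ T₂, Apart z (side M) (pos₂ j) (side j) := by
    intro j hj
    obtain ⟨a, b, c, d⟩ := h₂.1 j hj
    rcases hz₂ with h | h
    · right; left; linarith
    · left; linarith
  have k₃ : ∀ j ∈ T₁, ∀ k ∈ T₂, Apart (pos₁ j) (side j) (pos₂ k) (side k) := by
    intro j hj k hk
    obtain ⟨a, b, c, d⟩ := h₁.1 j hj
    obtain ⟨a', b', c', d'⟩ := h₂.1 k hk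
    rcases h₁₂ with h | h
    · right; right; left; linarith
    · right; right; right; linarith
  refine ⟨fun j hj => ?_, fun j hj k hk hjk => ?_⟩
  · simp only [Finset.mem_insert, Finset.mem_union] at hj
    rcases hj with rfl | hj | hj
    · simpa using hz
    · obtain ⟨a, b, c, d⟩ := h₁.1 j hj
      simp only [if_neg (hne₁ j hj), if_pos hj]
      exact ⟨by linarith, by linarith, by linarith, by linarith⟩
    · obtain ⟨a, b, c, d⟩ := h₂.1 j hj
      simp only [if_neg (hne₂ j hj), if_neg (hn₂ j hj)]
      exact ⟨by linarith, by linarith, by linarith, by linarith⟩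
  · simp only [Finset.mem_insert, Finset.mem_union] at hj hk
    rcases hj with rfl | hj | hj <;> rcases hk with rfl | hk | hk
    · exact absurd rfl hjk
    · simpa only [if_true, if_neg (hne₁ k hk), if_pos hk] using k₁ k hk
    · simpa only [if_true, if_neg (hne₂ k hk), if_neg (hn₂ k hk)] using k₂ k hk
    · simpa only [if_true, if_neg (hne₁ j hj), if_pos hj] using (k₁ j hj).symm
    · simpa only [if_neg (hne₁ j hj), if_pos hj, if_neg (hne₁ k hk), if_pos hk]
        using h₁.2 j hj k hk hjk
    · simpa only [if_neg (hne₁ j hj), if_pos hj, if_neg (hne₂ k hk), if_neg (hn₂ k hk)]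
        using k₃ j hj k hk
    · simpa only [if_true, if_neg (hne₂ j hj), if_neg (hn₂ j hj)] using (k₂ j hj).symm
    · simpa only [if_neg (hne₁ k hk), if_pos hk, if_neg (hne₂ j hj), if_neg (hn₂ j hj)]
        using (k₃ k hk j hj).symm
    · simpa only [if_neg (hne₂ j hj), if_neg (hn₂ j hj), if_neg (hne₂ k hk), if_neg (hn₂ k hk)]
        using h₂.2 j hj k hk hjk

/-- A large item whose horizontal slab meets no other large item is placed in a corner of the
rectangle; the other items are handled in what is left of the rectangle beside the slab. -/
lemma Setting.reach_of_slab (hS : Setting side profit t s δ)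
    (h : Packed side S pos x₀ x₁ y₀ y₁) {M : ι} (hM : M ∈ S) (hMt : t ≤ side M)
    (hsep : ∀ j ∈ S, t ≤ side j → j ≠ M →
      (pos j).2 + side j ≤ (pos M).2 ∨ (pos M).2 + side M ≤ (pos j).2)
    {u v v' w : ℝ} (hu : u = y₀ ∧ v = y₀ + side M ∧ v' = y₁ ∨
      u = y₁ - side M ∧ v = y₀ ∧ v' = y₁ - side M) (hw : w = x₀ ∨ w = x₁ - side M)
    (hcorner : CornerOK B (w, u) (side M)) {k : ℕ}
    (hrec : ∀ T pos', T.filter (fun j => t ≤ side j) = (S.filter fun j => t ≤ side j).erase M →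
      Packed side T pos' x₀ x₁ v v' →
      Reach side profit t δ (addBlocked B (w, u) (side M)) T x₀ x₁ v v' k) :
    Reach side profit t δ B S x₀ x₁ y₀ y₁ (k + 1) := by
  obtain ⟨T₁, pos₁, T₂, pos₂, hT₁, hT₂, hdisj, hlarge, hp₁, hp₂, hle⟩ :=
    hS.exists_cut_slab h hM hMt hsep
  have hfilter : T₁.filter (fun j => t ≤ side j) = (S.filter fun j => t ≤ side j).erase M := by
    ext j
    simp only [Finset.mem_filter, Finset.mem_erase]
    constructor
    · rintro ⟨h₁, h₂⟩
      have := Finset.mem_erase.1 (hT₁ h₁)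
      exact ⟨this.1, this.2, h₂⟩
    · rintro ⟨h₁, h₂, h₃⟩
      exact ⟨hlarge j h₂ h₃ h₁, h₃⟩
  have hMpos := hS.side_pos M
  obtain ⟨m₁, m₂, m₃, m₄⟩ := h.1 M hM
  have hp₁' : Packed side T₁ (fun j => ((pos₁ j).1 + 0, (pos₁ j).2 + (v - y₀))) x₀ x₁ v v' := by
    rcases hu with ⟨-, hv, hv'⟩ | ⟨-, hv, hv'⟩ <;>
      exact hp₁.translate 0 (v - y₀) (by linarith) (by linarith) (by linarith) (by linarith)
  obtain ⟨T', hT', pos', l, hp', hl, hlT, hlT', hc, hle'⟩ := hrec _ _ hfilter hp₁'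
  -- `w'` is the left end of the part of the slab beside `M`, which receives `T₂`.
  obtain ⟨w', hw'₀, hw'₁, hw'⟩ : ∃ w', x₀ ≤ w' ∧ w' + (x₁ - x₀ - side M) ≤ x₁ ∧
      (w' + (x₁ - x₀ - side M) ≤ w ∨ w + side M ≤ w') := by
    rcases hw with hw | hw
    · exact ⟨x₀ + side M, by linarith, by linarith, by right; linarith⟩
    · exact ⟨x₀, by linarith, by linarith, by left; linarith⟩
  have hp₂' := hp₂.translate w' u le_rfl le_rfl le_rfl le_rfl
  have hMT' : M ∉ T' := fun hc => by simpa using hT₁ (hT' hc)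
  have hMT₂ : M ∉ T₂ := fun hc => by simpa using hT₂ hc
  have hdisj' : Disjoint T' T₂ := Finset.disjoint_of_subset_left hT' hdisj
  have hglue := Packed.glue (M := M) (z := (w, u)) (x₀ := x₀) (x₁ := x₁) (y₀ := y₀) (y₁ := y₁)
    hp' hp₂'
    (by
      refine ⟨?_, ?_, ?_, ?_⟩ <;> simp only <;> rcases hu with hu | hu <;>
        rcases hw with hw | hw <;> linarith)
    le_rfl le_rfl (by rcases hu with hu | hu <;> linarith) (by rcases hu with hu | hu <;> linarith)
    (by linarith) (by linarith) (by rcases hu with hu | hu <;> linarith)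
    (by rcases hu with hu | hu <;> linarith) hMT' hMT₂ hdisj'
    (by rcases hu with hu | hu
        · right; simp only; linarith
        · left; simp only; linarith)
    (by rcases hw' with hw' | hw'
        · left; simp only; linarith
        · right; simp only; linarith)
    (by rcases hu with hu | hu
        · right; linarith
        · left; linarith)
  -- `T₂` contains only small items, so it stays out of the list and blocks no quadrant.
  refine ⟨insert M (T' ∪ T₂), ?_, _, M :: l, hglue, ?_, ?_, ?_, ⟨?_, ?_⟩, ?_⟩
  · intro j hj
    simp only [Finset.mem_insert, Finset.mem_union] at hj
    rcases hj with rfl | hj | hj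
    · exact hM
    · exact Finset.mem_of_mem_erase (hT₁ (hT' hj))
    · exact Finset.mem_of_mem_erase (hT₂ hj)
  · exact List.nodup_cons.2 ⟨fun hc => hMT' (hlT' M hc), hl⟩
  · intro j
    have := Finset.ext_iff.1 hfilter j
    simp only [Finset.mem_filter, Finset.mem_erase] at this
    rw [List.mem_cons, hlT, this]
    by_cases hj : j = M
    · subst hj; simp [hM, hMt]
    · simp [hj]
  · intro j hj
    rcases List.mem_cons.1 hj with rfl | hj
    · simp
    · simp [hlT' j hj]
  · simpa using hcorner
  · simp only [if_true]
    refine hc.congr fun j hj => ?_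
    have hjT := hlT' j hj
    have hjM : j ≠ M := fun hc => hMT' (hc ▸ hjT)
    rw [if_neg hjM, if_pos hjT]
  · rw [Finset.sum_insert (by simp [hMT', hMT₂]), Finset.sum_union hdisj']
    have hTle : ∑ j ∈ T₁, profit j ≤ ∑ j ∈ S, profit j :=
      Finset.sum_le_sum_of_subset_of_nonneg (hT₁.trans (Finset.erase_subset _ _))
        fun j _ _ => hS.profit_nonneg j
    have hkδ : 0 ≤ k * δ := mul_nonneg (Nat.cast_nonneg _) hS.δ_nonneg
    have := mul_le_mul_of_nonneg_left hTle hkδ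
    push_cast
    linarith

lemma Setting.reach_of_slab_swap (hS : Setting side profit t s δ)
    (h : Packed side S pos x₀ x₁ y₀ y₁) {M : ι} (hM : M ∈ S) (hMt : t ≤ side M)
    (hsep : ∀ j ∈ S, t ≤ side j → j ≠ M →
      (pos j).1 + side j ≤ (pos M).1 ∨ (pos M).1 + side M ≤ (pos j).1)
    {u v v' w : ℝ} (hu : u = x₀ ∧ v = x₀ + side M ∧ v' = x₁ ∨
      u = x₁ - side M ∧ v = x₀ ∧ v' = x₁ - side M) (hw : w = y₀ ∨ w = y₁ - side M)
    (hcorner : CornerOK B (u, w) (side M)) {k : ℕ}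
    (hrec : ∀ T pos', T.filter (fun j => t ≤ side j) = (S.filter fun j => t ≤ side j).erase M →
      Packed side T pos' v v' y₀ y₁ →
      Reach side profit t δ (addBlocked B (u, w) (side M)) T v v' y₀ y₁ k) :
    Reach side profit t δ B S x₀ x₁ y₀ y₁ (k + 1) := by
  refine Reach.swap (hS.reach_of_slab h.swap hM hMt hsep hu hw hcorner.swap fun T pos' hT hp => ?_)
  have := addBlocked_swap (B := B) (u, w) (side M)
  rw [Prod.swap_prod_mk] at this
  rw [this]
  exact Reach.swap (hrec T _ hT hp.swap)

/-- At most one large item can be placed in the upper right corner. -/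
lemma Setting.reach_of_card_le_one (hS : Setting side profit t s δ)
    (h : Packed side S pos x₀ x₁ y₀ y₁) (hcard : (S.filter fun j => t ≤ side j).card ≤ 1)
    (hT : B x₁ y₁ false true) (hR : B x₁ y₁ true false) :
    Reach side profit t δ B S x₀ x₁ y₀ y₁ 1 := by
  rcases Nat.le_one_iff_eq_zero_or_eq_one.1 hcard with hc | hc
  · exact (reach_of_no_large h (Finset.card_eq_zero.1 hc)).mono hS (by norm_num)
  · obtain ⟨Q, hQ⟩ := Finset.card_eq_one.1 hc
    have hQS : Q ∈ S ∧ t ≤ side Q := Finset.mem_filter.1 (hQ ▸ Finset.mem_singleton_self Q)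
    refine hS.reach_of_slab h hQS.1 hQS.2 (fun j hj hjt hjQ => ?_) (Or.inr ⟨rfl, rfl, rfl⟩)
      (Or.inr rfl) ⟨false, false, ?_, ?_⟩ fun T pos' hT hp => ?_
    · exact absurd (Finset.mem_singleton.1 (hQ ▸ Finset.mem_filter.2 ⟨hj, hjt⟩)) hjQ
    · simpa [endpoint] using hR
    · simpa [endpoint] using hT
    · exact reach_of_no_large hp (by rw [hT, hQ]; simp)

/-- At most two large items can be placed at the upper corners and at the right wall. -/
lemma Setting.reach_of_card_le_two (hS : Setting side profit t s δ)
    (h : Packed side S pos x₀ x₁ y₀ y₁) (hcard : (S.filter fun j => t ≤ side j).card ≤ 2)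
    (hL : B x₀ y₁ false false) (hT : ∀ x σ, B x y₁ σ true) (hR : ∀ y τ, B x₁ y true τ) :
    Reach side profit t δ B S x₀ x₁ y₀ y₁ 2 := by
  rcases Nat.lt_or_ge (S.filter fun j => t ≤ side j).card 2 with hc | hc
  · exact (hS.reach_of_card_le_one h (by omega) (hT _ _) (hR _ _)).mono hS (by norm_num)
  obtain ⟨P, Q, hPQ, hF⟩ := Finset.card_eq_two.1 (le_antisymm hcard hc)
  have hmem : ∀ j, (j ∈ S ∧ t ≤ side j) ↔ j = P ∨ j = Q := fun j => by
    simpa using Finset.ext_iff.1 hF j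
  obtain ⟨hPS, hPt⟩ := (hmem P).2 (Or.inl rfl)
  obtain ⟨hQS, hQt⟩ := (hmem Q).2 (Or.inr rfl)
  have hP := hS.side_pos P
  have hcard' : ∀ T : Finset ι, T.filter (fun j => t ≤ side j) =
      (S.filter fun j => t ≤ side j).erase P → (T.filter fun j => t ≤ side j).card ≤ 1 := by
    intro T hT
    rw [hT, Finset.card_erase_of_mem (Finset.mem_filter.2 ⟨hPS, hPt⟩)]
    omega
  have hA := h.2 Q hQS P hPS hPQ.symm
  by_cases hx : (pos Q).1 + side Q ≤ (pos P).1 ∨ (pos P).1 + side P ≤ (pos Q).1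
  · refine hS.reach_of_slab_swap h hPS hPt (fun j hj hjt hjP => ?_) (Or.inl ⟨rfl, rfl, rfl⟩)
      (Or.inr rfl) ⟨true, false, ?_, ?_⟩ fun T pos' hT' hp => ?_
    · rcases (hmem j).1 ⟨hj, hjt⟩ with rfl | rfl
      · exact absurd rfl hjP
      · exact hx
    · simpa [endpoint] using hL
    · simpa [endpoint] using hT _ _
    · exact hS.reach_of_card_le_one hp (hcard' T hT') (Or.inl (hT _ _)) (Or.inl (hR _ _))
  -- In the upper right corner, the lower edge of `P` acts as the ceiling of the corner beneath it.
  · refine hS.reach_of_slab h hPS hPt (fun j hj hjt hjP => ?_) (Or.inr ⟨rfl, rfl, rfl⟩)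
      (Or.inr rfl) ⟨false, false, ?_, ?_⟩ fun T pos' hT' hp => ?_
    · rcases (hmem j).1 ⟨hj, hjt⟩ with rfl | rfl
      · exact absurd rfl hjP
      · rcases hA with a | a | a | a
        · exact absurd (Or.inl a) hx
        · exact absurd (Or.inr a) hx
        · exact Or.inl a
        · exact Or.inr a
    · simpa [endpoint] using hR _ _
    · simpa [endpoint] using hT _ _
    · refine hS.reach_of_card_le_one hp (hcard' T hT') (Or.inr ?_) (Or.inl (hR _ _))
      simp only [Beside]
      refine ⟨⟨?_, ?_⟩, ?_, ?_⟩ <;> linarith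

/-- At most three large items can be placed by corner packing if the lower right corner of the
rectangle is the only one that is not available. -/
lemma Setting.reach_of_card_le_three (hS : Setting side profit t s δ)
    (h : Packed side S pos x₀ x₁ y₀ y₁) (hcard : (S.filter fun j => t ≤ side j).card ≤ 3)
    (hL : ∀ y τ, B x₀ y false τ) (hBL : B x₀ y₀ true false)
    (hT : ∀ x σ, B x y₁ σ true) (hR : ∀ y τ, B x₁ y true τ) :
    Reach side profit t δ B S x₀ x₁ y₀ y₁ 3 := by
  rcases Nat.lt_or_ge (S.filter fun j => t ≤ side j).card 3 with hc | hc
  · exact (hS.reach_of_card_le_two h (by omega) (hL _ _) hT hR).mono hS (by norm_num)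
  obtain ⟨P, Q, R, hPQ, hPR, hQR, hF⟩ := Finset.card_eq_three.1 (le_antisymm hcard hc)
  have hmem : ∀ j, (j ∈ S ∧ t ≤ side j) ↔ j = P ∨ j = Q ∨ j = R := fun j => by
    simpa using Finset.ext_iff.1 hF j
  obtain ⟨hPS, hPt⟩ := (hmem P).2 (Or.inl rfl)
  obtain ⟨hQS, hQt⟩ := (hmem Q).2 (Or.inr (Or.inl rfl))
  obtain ⟨hRS, hRt⟩ := (hmem R).2 (Or.inr (Or.inr rfl))
  have hcard' : ∀ N ∈ S, t ≤ side N → ∀ T : Finset ι, T.filter (fun j => t ≤ side j) =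
      (S.filter fun j => t ≤ side j).erase N → (T.filter fun j => t ≤ side j).card ≤ 2 := by
    intro N hN hNt T hT
    rw [hT, Finset.card_erase_of_mem (Finset.mem_filter.2 ⟨hN, hNt⟩)]
    omega
  have key : ∃ N ∈ S, t ≤ side N ∧ ((∀ j ∈ S, t ≤ side j → j ≠ N →
        (pos j).1 + side j ≤ (pos N).1 ∨ (pos N).1 + side N ≤ (pos j).1) ∨
      (∀ j ∈ S, t ≤ side j → j ≠ N →
        (pos j).2 + side j ≤ (pos N).2 ∨ (pos N).2 + side N ≤ (pos j).2)) := by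
    obtain ⟨N, hN, hN'⟩ := exists_uniform_of_three
      (X := fun j k => (pos j).1 + side j ≤ (pos k).1 ∨ (pos k).1 + side k ≤ (pos j).1)
      (Y := fun j k => (pos j).2 + side j ≤ (pos k).2 ∨ (pos k).2 + side k ≤ (pos j).2)
      (fun j k => Or.symm) (fun j k => Or.symm) (or_assoc.2 (h.2 P hPS Q hQS hPQ))
      (or_assoc.2 (h.2 P hPS R hRS hPR)) (or_assoc.2 (h.2 Q hQS R hRS hQR))
    obtain ⟨hNS, hNt⟩ := (hmem N).2 hN
    exact ⟨N, hNS, hNt, hN'.imp (fun H j hj hjt => H j ((hmem j).1 ⟨hj, hjt⟩))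
      (fun H j hj hjt => H j ((hmem j).1 ⟨hj, hjt⟩))⟩
  obtain ⟨N, hNS, hNt, hN | hN⟩ := key
  · have hNpos := hS.side_pos N
    -- At the upper left, the right edge of `N` supplies the upper left corner needed for the other
    -- two items.
    refine hS.reach_of_slab_swap h hNS hNt hN (Or.inl ⟨rfl, rfl, rfl⟩)
      (Or.inr rfl) ⟨true, false, ?_, ?_⟩ fun T pos' hT' hp => ?_
    · simpa [endpoint] using hL _ _
    · simpa [endpoint] using hT _ _
    · refine hS.reach_of_card_le_two hp (hcard' N hNS hNt T hT') (Or.inr ?_)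
        (fun _ _ => Or.inl (hT _ _)) (fun _ _ => Or.inl (hR _ _))
      simp only [Beside]
      refine ⟨⟨?_, ?_⟩, ?_, ?_⟩ <;> linarith
  · refine hS.reach_of_slab h hNS hNt hN (Or.inl ⟨rfl, rfl, rfl⟩)
      (Or.inl rfl) ⟨true, true, ?_, ?_⟩ fun T pos' hT' hp => ?_
    · simpa [endpoint] using hL _ _
    · simpa [endpoint] using hBL
    · exact hS.reach_of_card_le_two hp (hcard' N hNS hNt T hT') (Or.inl (hL _ _))
        (fun _ _ => Or.inl (hT _ _)) (fun _ _ => Or.inl (hR _ _))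

end SquarePacking

/-! ### Slides, and four large squares. -/

namespace SquarePacking

variable {ι : Type*} {side profit : ι → ℝ} {t s δ : ℝ} {S T : Finset ι} {pos pos' : ι → ℝ × ℝ}
  {x₀ x₁ y₀ y₁ : ℝ} {B : ℝ → ℝ → Bool → Bool → Prop}

lemma Setting.exists_move_right (hS : Setting side profit t s δ)
    (h : Packed side S pos x₀ x₁ y₀ y₁) {A : ι} (hA : A ∈ S) (hAt : t ≤ side A)
    (hfree : ∀ j ∈ S, t ≤ side j → j ≠ A → (pos A).1 + side A ≤ (pos j).1 →
      (pos j).2 + side j ≤ (pos A).2 ∨ (pos A).2 + side A ≤ (pos j).2) :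
    ∃ S' ⊆ S, ∃ pos', (∀ j ∈ S, t ≤ side j → j ∈ S') ∧ Packed side S' pos' x₀ x₁ y₀ y₁ ∧
      pos' A = (x₁ - side A, (pos A).2) ∧ (∀ j, t ≤ side j → j ≠ A → pos' j = pos j) ∧
      ∑ j ∈ S, profit j ≤ ∑ j ∈ S', profit j + δ * ∑ j ∈ S, profit j := by
  obtain ⟨S', hS', pos', hl, hp, hpA, hpj, hle⟩ := hS.exists_move_left h.flip hA hAt
    (fun j hj hjt hjA hjx => hfree j hj hjt hjA (by simp only at hjx; linarith))
  refine ⟨S', hS', _, hl, hp.flip, ?_, fun j hjt hjA => ?_, hle⟩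
  · simp only [hpA, Prod.mk.injEq, and_true]
    ring
  · simp only [hpj j hjt hjA]
    ext
    · simp only; ring
    · rfl

/-- Successive losses add up, because the second is a fraction of the smaller profit of `S₁`. -/
lemma Setting.loss_trans (hS : Setting side profit t s δ) {S₁ S₂ : Finset ι} (h₁ : S₁ ⊆ S)
    {k₁ k₂ : ℝ} (hk : 0 ≤ k₂)
    (hle₁ : ∑ j ∈ S, profit j ≤ ∑ j ∈ S₁, profit j + k₁ * δ * ∑ j ∈ S, profit j)
    (hle₂ : ∑ j ∈ S₁, profit j ≤ ∑ j ∈ S₂, profit j + k₂ * δ * ∑ j ∈ S₁, profit j) :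
    ∑ j ∈ S, profit j ≤ ∑ j ∈ S₂, profit j + (k₁ + k₂) * δ * ∑ j ∈ S, profit j := by
  have := mul_le_mul_of_nonneg_left (Finset.sum_le_sum_of_subset_of_nonneg h₁
    fun j _ _ => hS.profit_nonneg j) (mul_nonneg hk hS.δ_nonneg)
  linarith

/-- If `A` and `D` lie to the left of `B` and `C`, they can be moved to the left wall and the other
two to the right wall. -/
lemma Setting.exists_spread (hS : Setting side profit t s δ)
    (h : Packed side S pos x₀ x₁ y₀ y₁) {A B C D : ι} (hnd : [A, B, C, D].Nodup)
    (hmem : ∀ j, j ∈ [A, B, C, D] ↔ j ∈ S ∧ t ≤ side j)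
    (hAB : (pos A).1 + side A ≤ (pos B).1) (hDC : (pos D).1 + side D ≤ (pos C).1)
    (hAD : (pos A).2 + side A ≤ (pos D).2 ∨ (pos D).2 + side D ≤ (pos A).2)
    (hBC : (pos B).2 + side B ≤ (pos C).2 ∨ (pos C).2 + side C ≤ (pos B).2)
    (hAC : (pos A).1 < (pos C).1 + side C) (hDB : (pos D).1 < (pos B).1 + side B) :
    ∃ S' ⊆ S, ∃ pos', (∀ j ∈ S, t ≤ side j → j ∈ S') ∧ Packed side S' pos' x₀ x₁ y₀ y₁ ∧
      pos' A = (x₀, (pos A).2) ∧ pos' D = (x₀, (pos D).2) ∧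
      pos' B = (x₁ - side B, (pos B).2) ∧ pos' C = (x₁ - side C, (pos C).2) ∧
      ∑ j ∈ S, profit j ≤ ∑ j ∈ S', profit j + 4 * δ * ∑ j ∈ S, profit j := by
  simp only [List.nodup_cons, List.mem_cons, List.not_mem_nil, or_false, not_or,
    not_false_eq_true, List.nodup_nil, and_true] at hnd
  obtain ⟨⟨nAB, nAC, nAD⟩, ⟨nBC, nBD⟩, nCD⟩ := hnd
  simp only [List.mem_cons, List.not_mem_nil, or_false] at hmem
  obtain ⟨mA, tA⟩ := (hmem A).1 (by tauto)
  obtain ⟨mB, tB⟩ := (hmem B).1 (by tauto)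
  obtain ⟨mC, tC⟩ := (hmem C).1 (by tauto)
  obtain ⟨mD, tD⟩ := (hmem D).1 (by tauto)
  have pA := hS.side_pos A
  have pB := hS.side_pos B
  have pC := hS.side_pos C
  have pD := hS.side_pos D
  have iB := (h.1 B mB).1
  have iC := (h.1 C mC).1
  -- Slides keep all heights of large items, so the vertical separation within each pair survives
  -- the slides of the others.
  obtain ⟨S₁, hS₁, pos₁, l₁, hp₁, hA₁, hj₁, hle₁⟩ := hS.exists_move_left h mA tA (by
    intro j hj hjt hjA hjx
    rcases (hmem j).2 ⟨hj, hjt⟩ with rfl | rfl | rfl | rfl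
    · exact absurd rfl hjA
    · linarith
    · linarith
    · exact hAD.symm)
  have eB₁ := hj₁ B tB (Ne.symm nAB)
  have eC₁ := hj₁ C tC (Ne.symm nAC)
  have eD₁ := hj₁ D tD (Ne.symm nAD)
  obtain ⟨S₂, hS₂, pos₂, l₂, hp₂, hD₂, hj₂, hle₂⟩ :=
    hS.exists_move_left hp₁ (l₁ D mD tD) tD (by
    intro j hj hjt hjA hjx
    rw [eD₁] at hjx ⊢
    rcases (hmem j).2 ⟨hS₁ hj, hjt⟩ with rfl | rfl | rfl | rfl
    · rw [hA₁]; exact hAD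
    · rw [eB₁] at hjx; linarith
    · rw [eC₁] at hjx; linarith
    · exact absurd rfl hjA)
  have eA₂ := hj₂ A tA nAD
  have eB₂ := hj₂ B tB nBD
  have eC₂ := hj₂ C tC nCD
  rw [hA₁] at eA₂
  rw [eB₁] at eB₂
  rw [eC₁] at eC₂
  rw [eD₁] at hD₂
  obtain ⟨S₃, hS₃, pos₃, l₃, hp₃, hB₃, hj₃, hle₃⟩ :=
    hS.exists_move_right hp₂ (l₂ B (l₁ B mB tB) tB) tB (by
    intro j hj hjt hjA hjx
    rw [eB₂] at hjx ⊢
    rcases (hmem j).2 ⟨hS₁ (hS₂ hj), hjt⟩ with rfl | rfl | rfl | rfl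
    · rw [eA₂] at hjx; simp only at hjx; linarith
    · exact absurd rfl hjA
    · rw [eC₂]; exact hBC.symm
    · rw [hD₂] at hjx; simp only at hjx; linarith)
  have eA₃ := hj₃ A tA nAB
  have eC₃ := hj₃ C tC (Ne.symm nBC)
  have eD₃ := hj₃ D tD (Ne.symm nBD)
  rw [eA₂] at eA₃
  rw [eB₂] at hB₃
  rw [eC₂] at eC₃
  rw [hD₂] at eD₃
  obtain ⟨S₄, hS₄, pos₄, l₄, hp₄, hC₄, hj₄, hle₄⟩ :=
    hS.exists_move_right hp₃ (l₃ C (l₂ C (l₁ C mC tC) tC) tC) tC (by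
    intro j hj hjt hjA hjx
    rw [eC₃] at hjx ⊢
    rcases (hmem j).2 ⟨hS₁ (hS₂ (hS₃ hj)), hjt⟩ with rfl | rfl | rfl | rfl
    · rw [eA₃] at hjx; simp only at hjx; linarith
    · rw [hB₃]; exact hBC
    · exact absurd rfl hjA
    · rw [eD₃] at hjx; simp only at hjx; linarith)
  rw [← one_mul δ] at hle₁ hle₂ hle₃ hle₄
  refine ⟨S₄, ((hS₄.trans hS₃).trans hS₂).trans hS₁, pos₄,
    fun j hj hjt => l₄ j (l₃ j (l₂ j (l₁ j hj hjt) hjt) hjt) hjt, hp₄, (hj₄ A tA nAC).trans eA₃,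
    (hj₄ D tD (Ne.symm nCD)).trans eD₃, (hj₄ B tB nBC).trans hB₃, ?_, ?_⟩
  · rw [hC₄, eC₃]
  · have hle := hS.loss_trans hS₁ (by norm_num) hle₁ (hS.loss_trans hS₂ (by norm_num) hle₂
      (hS.loss_trans hS₃ zero_le_one hle₃ hle₄))
    norm_num at hle ⊢
    exact hle

/-- Items in corners of the bin are placed by corner packing. -/
lemma cornerSeq_of_walls {l : List ι} :
    ∀ {B : ℝ → ℝ → Bool → Bool → Prop}, (∀ y τ, B x₀ y false τ) → (∀ y τ, B x₁ y true τ) →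
    (∀ x σ, B x y₀ σ false) → (∀ x σ, B x y₁ σ true) →
    (∀ j ∈ l, ((pos j).1 = x₀ ∨ (pos j).1 + side j = x₁) ∧
      ((pos j).2 = y₀ ∨ (pos j).2 + side j = y₁)) → CornerSeq side pos B l := by
  induction l with
  | nil => intros; trivial
  | cons q l ih =>
    intro B hL hR hB hT hl
    refine ⟨?_, ih (fun _ _ => Or.inl (hL _ _)) (fun _ _ => Or.inl (hR _ _))
      (fun _ _ => Or.inl (hB _ _)) (fun _ _ => Or.inl (hT _ _)) fun j hj => hl j (by simp [hj])⟩
    obtain ⟨hx | hx, hy | hy⟩ := hl q (by simp)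
    · exact ⟨true, true, by simpa [endpoint, hx] using hL _ _, by simpa [endpoint, hy] using hB _ _⟩
    · exact ⟨true, false, by simpa [endpoint, hx] using hL _ _,
        by simpa [endpoint, hy] using hT _ _⟩
    · exact ⟨false, true, by simpa [endpoint, hx] using hR _ _,
        by simpa [endpoint, hy] using hB _ _⟩
    · exact ⟨false, false, by simpa [endpoint, hx] using hR _ _,
        by simpa [endpoint, hy] using hT _ _⟩

/-- `P`, `Q` form the lower row and `U`, `R` the upper one. A horizontal spread takes the squares to
the side walls at unchanged heights; a spread of the transposed packing takes them to floor and
ceiling. Each loses at most `4 * δ`. -/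
lemma Setting.reach_of_oriented_grid (hS : Setting side profit t s δ)
    (h : Packed side S pos x₀ x₁ y₀ y₁) {P Q R U : ι} (hnd : [P, Q, R, U].Nodup)
    (hmem : ∀ j, j ∈ [P, Q, R, U] ↔ j ∈ S ∧ t ≤ side j)
    (hL : ∀ y τ, B x₀ y false τ) (hR : ∀ y τ, B x₁ y true τ)
    (hB : ∀ x σ, B x y₀ σ false) (hT : ∀ x σ, B x y₁ σ true)
    (hPQ : (pos P).1 + side P ≤ (pos Q).1) (hPU : (pos P).2 + side P ≤ (pos U).2)
    (hPQ' : ¬((pos P).2 + side P ≤ (pos Q).2 ∨ (pos Q).2 + side Q ≤ (pos P).2))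
    (hRU' : ¬((pos R).2 + side R ≤ (pos U).2 ∨ (pos U).2 + side U ≤ (pos R).2))
    (hPU' : ¬((pos P).1 + side P ≤ (pos U).1 ∨ (pos U).1 + side U ≤ (pos P).1))
    (hQR' : ¬((pos Q).1 + side Q ≤ (pos R).1 ∨ (pos R).1 + side R ≤ (pos Q).1)) :
    Reach side profit t δ B S x₀ x₁ y₀ y₁ 8 := by
  have hnd' : [P, U, R, Q].Nodup := by
    simp only [List.nodup_cons, List.mem_cons, List.not_mem_nil, or_false, not_or] at hnd ⊢
    grind
  have hm : ∀ j, j ∈ [P, Q, R, U] → j ∈ S ∧ t ≤ side j := fun j => (hmem j).1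
  simp only [List.mem_cons, List.not_mem_nil, or_false] at hm
  obtain ⟨mP, tP⟩ := hm P (by tauto)
  obtain ⟨mQ, tQ⟩ := hm Q (by tauto)
  obtain ⟨mR, tR⟩ := hm R (by tauto)
  obtain ⟨mU, tU⟩ := hm U (by tauto)
  have nQR : Q ≠ R := by rintro rfl; simp at hnd
  have nUR : R ≠ U := by rintro rfl; simp at hnd
  have pP := hS.side_pos P
  have pQ := hS.side_pos Q
  have pR := hS.side_pos R
  have pU := hS.side_pos U
  push Not at hPQ' hRU' hPU' hQR'
  have hUR : (pos U).1 + side U ≤ (pos R).1 := by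
    rcases h.2 R mR U mU nUR with a | a | a | a <;> linarith
  have hQR : (pos Q).2 + side Q ≤ (pos R).2 := by
    rcases h.2 Q mQ R mR nQR with a | a | a | a <;> linarith
  obtain ⟨S₁, hS₁, pos₁, l₁, hp₁, eP, eU, eQ, eR, hle₁⟩ := hS.exists_spread h hnd hmem hPQ hUR
    (Or.inl hPU) (Or.inl hQR) (by linarith) (by linarith)
  obtain ⟨iP₁, iP₂, -⟩ := h.1 P mP
  obtain ⟨iQ₁, iQ₂, -⟩ := h.1 Q mQ
  obtain ⟨iR₁, iR₂, -⟩ := h.1 R mR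
  obtain ⟨iU₁, iU₂, -⟩ := h.1 U mU
  obtain ⟨S₂, hS₂, pos₂, l₂, hp₂, eP', eQ', eU', eR', hle₂⟩ := hS.exists_spread hp₁.swap hnd'
    (fun j => by
      have := hmem j
      simp only [List.mem_cons, List.not_mem_nil, or_false] at this ⊢
      constructor
      · intro hj
        have := this.1 (by tauto)
        exact ⟨l₁ j this.1 this.2, this.2⟩
      · intro hj
        have := this.2 ⟨hS₁ hj.1, hj.2⟩
        tauto)
    (by simpa [eP, eU] using hPU) (by simpa [eQ, eR] using hQR)
    -- Left and right squares stay separated at the walls, since their original row shows that their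
    -- widths fit into `x₁ - x₀`.
    (by left; simp only [eP, eQ, Prod.snd_swap]; linarith)
    (by left; simp only [eU, eR, Prod.snd_swap]; linarith)
    (by simp only [eP, eR, Prod.fst_swap]; linarith)
    (by simp only [eQ, eU, Prod.fst_swap]; linarith)
  simp only [eP, eQ, eR, eU, Prod.snd_swap] at eP' eQ' eU' eR'
  refine ⟨S₂, hS₂.trans hS₁, _, [P, Q, R, U], hp₂.swap, hnd, hmem, ?_, ?_, ?_⟩
  · intro j hj
    obtain ⟨h₁, h₂⟩ := (hmem j).1 hj
    exact l₂ j (l₁ j h₁ h₂) h₂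
  · refine cornerSeq_of_walls hL hR hB hT fun j hj => ?_
    simp only [List.mem_cons, List.not_mem_nil, or_false] at hj
    rcases hj with rfl | rfl | rfl | rfl
    · simp [eP']
    · simp [eQ']
    · simp [eR']
    · simp [eU']
  · refine (hS.loss_trans hS₁ (by norm_num) hle₁ hle₂).trans_eq ?_
    norm_num

/-- Four large items in two overlapping rows and two overlapping columns can be moved to the four
corners of the bin. -/
lemma Setting.reach_of_grid (hS : Setting side profit t s δ)
    (h : Packed side S pos x₀ x₁ y₀ y₁) {P Q R U : ι} (hnd : [P, Q, R, U].Nodup)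
    (hmem : ∀ j, j ∈ [P, Q, R, U] ↔ j ∈ S ∧ t ≤ side j)
    (hL : ∀ y τ, B x₀ y false τ) (hR : ∀ y τ, B x₁ y true τ)
    (hB : ∀ x σ, B x y₀ σ false) (hT : ∀ x σ, B x y₁ σ true)
    (hPQ : ¬((pos P).2 + side P ≤ (pos Q).2 ∨ (pos Q).2 + side Q ≤ (pos P).2))
    (hRU : ¬((pos R).2 + side R ≤ (pos U).2 ∨ (pos U).2 + side U ≤ (pos R).2))
    (hPU : ¬((pos P).1 + side P ≤ (pos U).1 ∨ (pos U).1 + side U ≤ (pos P).1))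
    (hQR : ¬((pos Q).1 + side Q ≤ (pos R).1 ∨ (pos R).1 + side R ≤ (pos Q).1)) :
    Reach side profit t δ B S x₀ x₁ y₀ y₁ 8 := by
  have hm : ∀ j, j ∈ [P, Q, R, U] → j ∈ S ∧ t ≤ side j := fun j => (hmem j).1
  simp only [List.mem_cons, List.not_mem_nil, or_false] at hm
  obtain ⟨mP, -⟩ := hm P (by tauto)
  obtain ⟨mQ, -⟩ := hm Q (by tauto)
  obtain ⟨mR, -⟩ := hm R (by tauto)
  obtain ⟨mU, -⟩ := hm U (by tauto)
  have nPQ : P ≠ Q := by rintro rfl; simp at hnd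
  have nPU : P ≠ U := by rintro rfl; simp at hnd
  have nRU : R ≠ U := by rintro rfl; simp at hnd
  have nQR : Q ≠ R := by rintro rfl; simp at hnd
  have perm : ∀ l : List ι, l.Perm [P, Q, R, U] →
      l.Nodup ∧ ∀ j, j ∈ l ↔ j ∈ S ∧ t ≤ side j :=
    fun l hl => ⟨hl.nodup_iff.2 hnd, fun j => hl.mem_iff.trans (hmem j)⟩
  have hPQ' : (pos P).1 + side P ≤ (pos Q).1 ∨ (pos Q).1 + side Q ≤ (pos P).1 := by
    have := h.2 P mP Q mQ nPQ; unfold Apart at this; tauto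
  have hPU' : (pos P).2 + side P ≤ (pos U).2 ∨ (pos U).2 + side U ≤ (pos P).2 := by
    have := h.2 P mP U mU nPU; unfold Apart at this; tauto
  have hRU' : (pos R).1 + side R ≤ (pos U).1 ∨ (pos U).1 + side U ≤ (pos R).1 := by
    have := h.2 R mR U mU nRU; unfold Apart at this; tauto
  have hQR' : (pos Q).2 + side Q ≤ (pos R).2 ∨ (pos R).2 + side R ≤ (pos Q).2 := by
    have := h.2 Q mQ R mR nQR; unfold Apart at this; tauto
  have pP := hS.side_pos P
  have pQ := hS.side_pos Q
  have pR := hS.side_pos R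
  have pU := hS.side_pos U
  have swap : ∀ {a b : Prop}, ¬(a ∨ b) → ¬(b ∨ a) := fun hab hc => hab hc.symm
  -- Any of the four squares may be at the lower left; relabelling makes it `P`.
  rcases hPQ' with a | a <;> rcases hPU' with b | b
  · exact hS.reach_of_oriented_grid h hnd hmem hL hR hB hT a b hPQ hRU hPU hQR
  · obtain ⟨h₁, h₂⟩ := perm [U, R, Q, P] (by simpa using List.reverse_perm [P, Q, R, U])
    refine hS.reach_of_oriented_grid h h₁ h₂ hL hR hB hT ?_ b (swap hRU) (swap hPQ) (swap hPU)
      (swap hQR)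
    push Not at hPU hQR
    rcases hRU' with c | c <;> linarith
  · obtain ⟨h₁, h₂⟩ := perm [Q, P, U, R]
      ((List.Perm.swap P Q [U, R]).trans (((List.Perm.swap R U []).cons Q).cons P))
    refine hS.reach_of_oriented_grid h h₁ h₂ hL hR hB hT a ?_ (swap hPQ) (swap hRU) hQR hPU
    push Not at hPQ hRU
    rcases hQR' with c | c <;> linarith
  · obtain ⟨h₁, h₂⟩ := perm [R, U, P, Q]
      (List.perm_append_comm (l₁ := [R, U]) (l₂ := [P, Q]))
    refine hS.reach_of_oriented_grid h h₁ h₂ hL hR hB hT ?_ ?_ hRU hPQ (swap hQR) (swap hPU)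
    · push Not at hPU hQR
      rcases hRU' with c | c <;> linarith
    · push Not at hPQ hRU
      rcases hQR' with c | c <;> linarith

/-- If `X` and `Y` exclude each other and each of four objects has a partner for both relations,
then the objects can be arranged in a cycle in which the relations alternate. -/
lemma exists_alternating_cycle {X Y : ι → ι → Prop} (hX : ∀ j k, X j k → X k j)
    (hY : ∀ j k, Y j k → Y k j) {P Q R U : ι}
    (hPQ : X P Q → ¬Y P Q) (hPR : X P R → ¬Y P R) (hPU : X P U → ¬Y P U)
    (hQR : X Q R → ¬Y Q R) (hQU : X Q U → ¬Y Q U) (hRU : X R U → ¬Y R U)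
    (hXP : X P Q ∨ X P R ∨ X P U) (hXQ : X Q P ∨ X Q R ∨ X Q U)
    (hXR : X R P ∨ X R Q ∨ X R U) (hXU : X U P ∨ X U Q ∨ X U R)
    (hYP : Y P Q ∨ Y P R ∨ Y P U) (hYQ : Y Q P ∨ Y Q R ∨ Y Q U)
    (hYR : Y R P ∨ Y R Q ∨ Y R U) (hYU : Y U P ∨ Y U Q ∨ Y U R) :
    (Y P Q ∧ Y R U ∧ X P U ∧ X Q R) ∨ (Y P Q ∧ Y U R ∧ X P R ∧ X Q U) ∨
    (Y P R ∧ Y Q U ∧ X P U ∧ X R Q) ∨ (Y P R ∧ Y U Q ∧ X P Q ∧ X R U) ∨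
    (Y P U ∧ Y Q R ∧ X P R ∧ X U Q) ∨ (Y P U ∧ Y R Q ∧ X P Q ∧ X U R) := by
  have a₁ : X Q P ↔ X P Q := ⟨hX _ _, hX _ _⟩
  have a₂ : X R P ↔ X P R := ⟨hX _ _, hX _ _⟩
  have a₃ : X U P ↔ X P U := ⟨hX _ _, hX _ _⟩
  have a₄ : X R Q ↔ X Q R := ⟨hX _ _, hX _ _⟩
  have a₅ : X U Q ↔ X Q U := ⟨hX _ _, hX _ _⟩
  have a₆ : X U R ↔ X R U := ⟨hX _ _, hX _ _⟩
  have b₁ : Y Q P ↔ Y P Q := ⟨hY _ _, hY _ _⟩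
  have b₂ : Y R P ↔ Y P R := ⟨hY _ _, hY _ _⟩
  have b₃ : Y U P ↔ Y P U := ⟨hY _ _, hY _ _⟩
  have b₄ : Y R Q ↔ Y Q R := ⟨hY _ _, hY _ _⟩
  have b₅ : Y U Q ↔ Y Q U := ⟨hY _ _, hY _ _⟩
  have b₆ : Y U R ↔ Y R U := ⟨hY _ _, hY _ _⟩
  clear hX hY
  rw [a₁] at hXQ
  rw [a₂, a₄] at hXR
  rw [a₃, a₅, a₆] at hXU
  rw [b₁] at hYQ
  rw [b₂, b₄] at hYR
  rw [b₃, b₅, b₆] at hYU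
  rw [a₄, a₅, a₆, b₄, b₅, b₆]
  clear a₁ a₂ a₃ a₄ a₅ a₆ b₁ b₂ b₃ b₄ b₅ b₆
  generalize X P Q = x₁ at *
  generalize X P R = x₂ at *
  generalize X P U = x₃ at *
  generalize X Q R = x₄ at *
  generalize X Q U = x₅ at *
  generalize X R U = x₆ at *
  generalize Y P Q = y₁ at *
  generalize Y P R = y₂ at *
  generalize Y P U = y₃ at *
  generalize Y Q R = y₄ at *
  generalize Y Q U = y₅ at *
  generalize Y R U = y₆ at *
  -- A graph on four vertices without isolated vertices has a perfect matching unless it is a star,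
  -- whose centre would be isolated for the other relation. Hence `X` and `Y` contain disjoint
  -- perfect matchings, whose union is the cycle.
  grind

lemma partners_of_forall_exists {Z : ι → ι → Prop} {P Q R U : ι}
    (hZ : ∀ N ∈ [P, Q, R, U], ∃ j ∈ [P, Q, R, U], j ≠ N ∧ Z N j) :
    (Z P Q ∨ Z P R ∨ Z P U) ∧ (Z Q P ∨ Z Q R ∨ Z Q U) ∧ (Z R P ∨ Z R Q ∨ Z R U) ∧
      (Z U P ∨ Z U Q ∨ Z U R) := by
  simp only [List.mem_cons, List.not_mem_nil, or_false, exists_eq_or_imp, exists_eq_left,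
    forall_eq_or_imp, forall_eq, ne_eq, not_true_eq_false, false_and, false_or] at hZ
  obtain ⟨a, b, c, d⟩ := hZ
  exact ⟨a.imp And.right (Or.imp And.right And.right),
    b.imp And.right (Or.imp And.right And.right), c.imp And.right (Or.imp And.right And.right),
    d.imp And.right (Or.imp And.right And.right)⟩

/-- At most four large items in a bin can be placed by corner packing. -/
lemma Setting.reach_of_card_le_four [DecidableEq ι] (hS : Setting side profit t s δ)
    (h : Packed side S pos x₀ x₁ y₀ y₁) (hcard : (S.filter fun j => t ≤ side j).card ≤ 4)
    (hL : ∀ y τ, B x₀ y false τ) (hR : ∀ y τ, B x₁ y true τ)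
    (hB : ∀ x σ, B x y₀ σ false) (hT : ∀ x σ, B x y₁ σ true) :
    Reach side profit t δ B S x₀ x₁ y₀ y₁ 8 := by
  have hcard' : ∀ N ∈ S, t ≤ side N → ∀ T : Finset ι, T.filter (fun j => t ≤ side j) =
      (S.filter fun j => t ≤ side j).erase N → (T.filter fun j => t ≤ side j).card ≤ 3 := by
    intro N hN hNt T hT
    rw [hT, Finset.card_erase_of_mem (Finset.mem_filter.2 ⟨hN, hNt⟩)]
    omega
  rcases Nat.lt_or_ge (S.filter fun j => t ≤ side j).card 4 with hc | hc
  · exact (hS.reach_of_card_le_three h (by omega) hL (hB _ _) hT hR).mono hS (by norm_num)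
  by_cases hy : ∃ N ∈ S, t ≤ side N ∧ ∀ j ∈ S, t ≤ side j → j ≠ N →
      (pos j).2 + side j ≤ (pos N).2 ∨ (pos N).2 + side N ≤ (pos j).2
  · obtain ⟨N, hNS, hNt, hN⟩ := hy
    have hNpos := hS.side_pos N
    -- With `N` at the lower left, the rectangle above lacks only its lower right corner.
    refine (hS.reach_of_slab (k := 3) h hNS hNt hN (Or.inl ⟨rfl, rfl, rfl⟩) (Or.inl rfl)
      ⟨true, true, ?_, ?_⟩ fun T pos' hT' hp => ?_).mono hS (by norm_num)
    · simpa [endpoint] using hL _ _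
    · simpa [endpoint] using hB _ _
    · refine hS.reach_of_card_le_three hp (hcard' N hNS hNt T hT') (fun _ _ => Or.inl (hL _ _))
        (Or.inr ?_) (fun _ _ => Or.inl (hT _ _)) (fun _ _ => Or.inl (hR _ _))
      simp only [Beside]
      refine ⟨⟨?_, ?_⟩, ?_, ?_⟩ <;> linarith
  by_cases hx : ∃ N ∈ S, t ≤ side N ∧ ∀ j ∈ S, t ≤ side j → j ≠ N →
      (pos j).1 + side j ≤ (pos N).1 ∨ (pos N).1 + side N ≤ (pos j).1
  · obtain ⟨N, hNS, hNt, hN⟩ := hx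
    have hNpos := hS.side_pos N
    -- Here the missing corner is the upper left one; transposition turns it into the lower right
    -- one.
    refine (hS.reach_of_slab_swap (k := 3) h hNS hNt hN (Or.inl ⟨rfl, rfl, rfl⟩) (Or.inl rfl)
      ⟨true, true, ?_, ?_⟩ fun T pos' hT' hp => Reach.swap ?_).mono hS (by norm_num)
    · simpa [endpoint] using hL _ _
    · simpa [endpoint] using hB _ _
    · refine hS.reach_of_card_le_three hp.swap (hcard' N hNS hNt T hT')
        (fun _ _ => Or.inl (hB _ _)) (Or.inr ?_) (fun _ _ => Or.inl (hR _ _))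
        (fun _ _ => Or.inl (hT _ _))
      simp only [Beside]
      refine ⟨⟨?_, ?_⟩, ?_, ?_⟩ <;> linarith
  obtain ⟨P, F, hPF, hF, hF3⟩ := Finset.card_eq_succ.1 (le_antisymm hcard hc)
  obtain ⟨Q, R, U, nQR, nQU, nRU, rfl⟩ := Finset.card_eq_three.1 hF3
  simp only [Finset.mem_insert, Finset.mem_singleton, not_or] at hPF
  obtain ⟨nPQ, nPR, nPU⟩ := hPF
  have hnd : [P, Q, R, U].Nodup := by simp [*]
  have hmem : ∀ j, j ∈ [P, Q, R, U] ↔ j ∈ S ∧ t ≤ side j := fun j => by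
    simpa using Finset.ext_iff.1 hF j
  have perm : ∀ l : List ι, l.Perm [P, Q, R, U] →
      l.Nodup ∧ ∀ j, j ∈ l ↔ j ∈ S ∧ t ≤ side j :=
    fun l hl => ⟨hl.nodup_iff.2 hnd, fun j => hl.mem_iff.trans (hmem j)⟩
  have hX : ∀ N ∈ [P, Q, R, U], ∃ j ∈ [P, Q, R, U], j ≠ N ∧
      ¬((pos N).1 + side N ≤ (pos j).1 ∨ (pos j).1 + side j ≤ (pos N).1) := by
    intro N hN
    by_contra hc
    refine hx ⟨N, ((hmem N).1 hN).1, ((hmem N).1 hN).2, fun j hj hjt hjN => ?_⟩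
    by_contra hc'
    exact hc ⟨j, (hmem j).2 ⟨hj, hjt⟩, hjN, fun hc'' => hc' hc''.symm⟩
  have hY : ∀ N ∈ [P, Q, R, U], ∃ j ∈ [P, Q, R, U], j ≠ N ∧
      ¬((pos N).2 + side N ≤ (pos j).2 ∨ (pos j).2 + side j ≤ (pos N).2) := by
    intro N hN
    by_contra hc
    refine hy ⟨N, ((hmem N).1 hN).1, ((hmem N).1 hN).2, fun j hj hjt hjN => ?_⟩
    by_contra hc'
    exact hc ⟨j, (hmem j).2 ⟨hj, hjt⟩, hjN, fun hc'' => hc' hc''.symm⟩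
  -- Squares that do not overlap cannot overlap in both projections.
  have excl : ∀ j ∈ [P, Q, R, U], ∀ k ∈ [P, Q, R, U], j ≠ k →
      ¬((pos j).1 + side j ≤ (pos k).1 ∨ (pos k).1 + side k ≤ (pos j).1) →
      ¬¬((pos j).2 + side j ≤ (pos k).2 ∨ (pos k).2 + side k ≤ (pos j).2) := by
    intro j hj k hk hjk hx' hy'
    rcases h.2 j ((hmem j).1 hj).1 k ((hmem k).1 hk).1 hjk with a | a | a | a
    exacts [hx' (Or.inl a), hx' (Or.inr a), hy' (Or.inl a), hy' (Or.inr a)]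
  obtain ⟨p₁, p₂, p₃, p₄⟩ := partners_of_forall_exists hX
  obtain ⟨q₁, q₂, q₃, q₄⟩ := partners_of_forall_exists hY
  rcases exists_alternating_cycle
      (X := fun j k => ¬((pos j).1 + side j ≤ (pos k).1 ∨ (pos k).1 + side k ≤ (pos j).1))
      (Y := fun j k => ¬((pos j).2 + side j ≤ (pos k).2 ∨ (pos k).2 + side k ≤ (pos j).2))
      (fun j k hjk hc => hjk hc.symm) (fun j k hjk hc => hjk hc.symm)
      (excl P (by simp) Q (by simp) nPQ) (excl P (by simp) R (by simp) nPR)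
      (excl P (by simp) U (by simp) nPU) (excl Q (by simp) R (by simp) nQR)
      (excl Q (by simp) U (by simp) nQU) (excl R (by simp) U (by simp) nRU)
      p₁ p₂ p₃ p₄ q₁ q₂ q₃ q₄ with
    ⟨a, b, c, d⟩ | ⟨a, b, c, d⟩ | ⟨a, b, c, d⟩ | ⟨a, b, c, d⟩ | ⟨a, b, c, d⟩ | ⟨a, b, c, d⟩
  · exact hS.reach_of_grid h hnd hmem hL hR hB hT a b c d
  · obtain ⟨h₁, h₂⟩ := perm [P, Q, U, R] (((List.Perm.swap R U []).cons Q).cons P)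
    exact hS.reach_of_grid h h₁ h₂ hL hR hB hT a b c d
  · obtain ⟨h₁, h₂⟩ := perm [P, R, Q, U] ((List.Perm.swap Q R [U]).cons P)
    exact hS.reach_of_grid h h₁ h₂ hL hR hB hT a b c d
  · obtain ⟨h₁, h₂⟩ := perm [P, R, U, Q]
      ((List.perm_append_comm (l₁ := [R, U]) (l₂ := [Q])).cons P)
    exact hS.reach_of_grid h h₁ h₂ hL hR hB hT a b c d
  · obtain ⟨h₁, h₂⟩ := perm [P, U, Q, R]
      ((List.perm_append_comm (l₁ := [U]) (l₂ := [Q, R])).cons P)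
    exact hS.reach_of_grid h h₁ h₂ hL hR hB hT a b c d
  · obtain ⟨h₁, h₂⟩ := perm [P, U, R, Q] ((List.reverse_perm [Q, R, U]).cons P)
    exact hS.reach_of_grid h h₁ h₂ hL hR hB hT a b c d

end SquarePacking

/-! ### From inequalities and blocked quadrants to the sets of the statement. -/

namespace SquarePacking

lemma isPacking_iff_packed {n : ℕ} {h : ℝ} {side : Fin n → ℝ} (hside : ∀ j, 0 < side j)
    {S : Finset (Fin n)} {pos : Fin n → ℝ × ℝ} :
    IsPacking h side S pos ↔ Packed side S pos 0 1 0 h := by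
  have hsub : ∀ j, square (pos j) (side j) ⊆ bin h ↔ Within 0 1 0 h (pos j) (side j) := by
    intro j
    have := hside j
    rw [square, bin, Set.prod_subset_prod_iff, Set.Icc_subset_Icc_iff (by linarith),
      Set.Icc_subset_Icc_iff (by linarith)]
    simp only [Set.Icc_eq_empty_iff, Within, and_assoc]
    constructor
    · rintro (h' | h' | h')
      · exact h'
      · linarith
      · linarith
    · exact Or.inl
  have hdisj : ∀ j k, Disjoint (interior (square (pos j) (side j)))
      (interior (square (pos k) (side k))) ↔ Apart (pos j) (side j) (pos k) (side k) := by
    intro j k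
    have := hside j
    have := hside k
    simp only [square, interior_prod_eq, interior_Icc, Set.disjoint_prod, Apart]
    rw [Set.disjoint_iff_inter_eq_empty, Set.disjoint_iff_inter_eq_empty, Set.Ioo_inter_Ioo,
      Set.Ioo_inter_Ioo, Set.Ioo_eq_empty_iff, Set.Ioo_eq_empty_iff]
    simp only [lt_inf_iff, sup_lt_iff]
    grind
  unfold IsPacking Packed
  simp only [hsub, hdisj]

/-- The quadrants at `(x, y)` that lie outside of the bin. -/
def outside (h x y : ℝ) (σ τ : Bool) : Prop :=
  (σ = false ∧ x ≤ 0) ∨ (σ = true ∧ 1 ≤ x) ∨ (τ = false ∧ y ≤ 0) ∨ (τ = true ∧ h ≤ y)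

/-- The sign given by a Boolean. -/
def sgn (σ : Bool) : ℝ := if σ then 1 else -1

lemma sgn_eq (σ : Bool) : sgn σ = 1 ∨ sgn σ = -1 := by
  cases σ <;> simp [sgn]

lemma sgn_not (σ : Bool) : sgn (!σ) = -sgn σ := by
  cases σ <;> simp [sgn]

lemma Beside.exists_radius {σ : Bool} {x lo hi : ℝ} (hx : Beside σ x lo hi) :
    ∃ r, 0 < r ∧ ∀ u, sgn σ * (u - x) ∈ Set.Ioo 0 r → u ∈ Set.Icc lo hi := by
  cases σ
  · refine ⟨x - lo, by linarith [hx.1], fun u hu => ?_⟩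
    simp only [sgn, Set.mem_Ioo, Bool.false_eq_true, if_false] at hu
    exact ⟨by linarith, by linarith [hx.2]⟩
  · refine ⟨hi - x, by linarith [hx.2], fun u hu => ?_⟩
    simp only [sgn, Set.mem_Ioo, if_true] at hu
    exact ⟨by linarith [hx.1], by linarith⟩

variable {n : ℕ} {h : ℝ} {side : Fin n → ℝ} {pos : Fin n → ℝ × ℝ}

lemma quadrantBox_mono {v : ℝ × ℝ} {σ τ r r' : ℝ} (hr : r ≤ r') :
    quadrantBox v σ τ r ⊆ quadrantBox v σ τ r' :=
  fun _ hz => ⟨⟨hz.1.1, hz.1.2.trans_le hr⟩, hz.2.1, hz.2.2.trans_le hr⟩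

/-- A wall blocks a quadrant completely; a placed square blocks it up to the nearer of its far
edges. -/
lemma exists_disjoint_quadrantBox {l : List (Fin n)} {v : ℝ × ℝ} {σ τ : Bool}
    (hv : outside h v.1 v.2 σ τ ∨ ∃ j ∈ l, Beside σ v.1 (pos j).1 ((pos j).1 + side j) ∧
      Beside τ v.2 (pos j).2 ((pos j).2 + side j)) :
    ∃ r, 0 < r ∧ Disjoint (quadrantBox v (sgn σ) (sgn τ) r) (uncovered h side pos l) := by
  rcases hv with hv | ⟨j, hj, h₁, h₂⟩
  · refine ⟨1, one_pos, Set.disjoint_left.2 fun z hz hzU => ?_⟩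
    have hzb := hzU.1
    simp only [bin, interior_prod_eq, interior_Icc, Set.mem_prod, Set.mem_Ioo] at hzb
    obtain ⟨⟨hz₁, -⟩, ⟨hz₂, -⟩⟩ := hz
    rcases hv with ⟨rfl, hv⟩ | ⟨rfl, hv⟩ | ⟨rfl, hv⟩ | ⟨rfl, hv⟩ <;>
      simp only [sgn, Bool.false_eq_true, if_false, if_true] at hz₁ hz₂ <;> linarith
  · obtain ⟨r₁, hr₁, H₁⟩ := h₁.exists_radius
    obtain ⟨r₂, hr₂, H₂⟩ := h₂.exists_radius
    refine ⟨min r₁ r₂, lt_min hr₁ hr₂, Set.disjoint_left.2 fun z hz hzU => hzU.2 ⟨j, hj, ?_⟩⟩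
    exact ⟨H₁ _ ⟨hz.1.1, hz.1.2.trans_le (min_le_left _ _)⟩,
      H₂ _ ⟨hz.2.1, hz.2.2.trans_le (min_le_right _ _)⟩⟩

lemma mem_Ioo_of_endpoint {σ : Bool} {x a u : ℝ}
    (hu : sgn σ * (u - endpoint σ x a) ∈ Set.Ioo 0 a) : u ∈ Set.Ioo x (x + a) := by
  cases σ <;>
    simp only [sgn, endpoint, Set.mem_Ioo, Bool.false_eq_true, if_false, if_true] at hu ⊢ <;>
    constructor <;> linarith

lemma CornerSeq.cornerOK {ι : Type*} {side : ι → ℝ} {pos : ι → ℝ × ℝ} {l₁ l₂ : List ι} {q : ι} :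
    ∀ {B : ℝ → ℝ → Bool → Bool → Prop}, CornerSeq side pos B (l₁ ++ q :: l₂) →
    CornerOK (fun x y σ τ => B x y σ τ ∨ ∃ j ∈ l₁, Beside σ x (pos j).1 ((pos j).1 + side j) ∧
      Beside τ y (pos j).2 ((pos j).2 + side j)) (pos q) (side q) := by
  induction l₁ with
  | nil => intro B hB; simpa [CornerOK] using hB.1
  | cons k l ih =>
    intro B hB
    obtain ⟨σ, τ, h₁, h₂⟩ := ih hB.2
    refine ⟨σ, τ, ?_, ?_⟩
    · simpa [addBlocked, or_assoc] using h₁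
    · simpa [addBlocked, or_assoc] using h₂

/-- The quadrant into which `q` extends is free automatically: up to radius `side q` it lies inside
`q`, hence in the bin and off the earlier squares. So `CornerOK` need only record the two adjacent
quadrants. -/
lemma CornerSeq.isCornerSequence (hside : ∀ j, 0 < side j) {S : Finset (Fin n)}
    (hp : Packed side S pos 0 1 0 h) {l : List (Fin n)} (hl : l.Nodup) (hlS : ∀ j ∈ l, j ∈ S)
    (hc : CornerSeq side pos (outside h) l) : IsCornerSequence h side pos l := by
  rintro l₁ q l₂ rfl
  obtain ⟨σ, τ, h₁, h₂⟩ := hc.cornerOK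
  set v : ℝ × ℝ := (endpoint σ (pos q).1 (side q), endpoint τ (pos q).2 (side q)) with hv
  obtain ⟨r₁, hr₁, H₁⟩ := exists_disjoint_quadrantBox (v := v) h₁
  obtain ⟨r₂, hr₂, H₂⟩ := exists_disjoint_quadrantBox (v := v) h₂
  have hqS := hlS q (by simp)
  refine ⟨v, ⟨sgn σ, sgn τ, min (side q) (min r₁ r₂), sgn_eq σ, sgn_eq τ,
    lt_min (hside q) (lt_min hr₁ hr₂), ?_, ?_, ?_⟩, ?_, ?_⟩
  · intro z hz
    have hz' := quadrantBox_mono (min_le_left _ _) hz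
    have hz₁ := mem_Ioo_of_endpoint hz'.1
    have hz₂ := mem_Ioo_of_endpoint hz'.2
    obtain ⟨a, b, c, d⟩ := hp.1 q hqS
    refine ⟨?_, ?_⟩
    · simp only [bin, interior_prod_eq, interior_Icc]
      exact ⟨⟨by linarith [hz₁.1], by linarith [hz₁.2]⟩,
        ⟨by linarith [hz₂.1], by linarith [hz₂.2]⟩⟩
    · rintro ⟨j, hj, hzj⟩
      have hjq : j ≠ q := by
        rintro rfl
        exact (List.nodup_append.1 hl).2.2 j hj j (by simp) rfl
      obtain ⟨⟨e₁, e₂⟩, e₃, e₄⟩ := hzj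
      rcases hp.2 j (hlS j (by simp [hj])) q hqS hjq with f | f | f | f
      · linarith [hz₁.1]
      · linarith [hz₁.2]
      · linarith [hz₂.1]
      · linarith [hz₂.2]
  · rw [← sgn_not]
    exact H₁.mono_left (quadrantBox_mono ((min_le_right _ _).trans (min_le_left _ _)))
  · rw [← sgn_not]
    exact H₂.mono_left (quadrantBox_mono ((min_le_right _ _).trans (min_le_right _ _)))
  · cases σ <;> simp [hv, endpoint]
  · cases τ <;> simp [hv, endpoint]

lemma totalProfit_le_cornerOpt {profit : Fin n → ℝ} (hprofit : ∀ j, 0 ≤ profit j) {t : ℝ}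
    {S : Finset (Fin n)} (hS : IsLargeCornerPacking h side t S pos) :
    totalProfit profit S ≤ cornerOpt h side profit t := by
  refine le_csSup ⟨∑ j, profit j, ?_⟩ ⟨S, pos, hS, rfl⟩
  rintro v ⟨T, -, -, rfl⟩
  exact Finset.sum_le_sum_of_subset_of_nonneg (Finset.subset_univ T) fun j _ _ => hprofit j

/-! ### The choice of parameters and the conclusion. -/

lemma setting_of_gap {ι : Type*} {side profit : ι → ℝ} {ε : ℝ} {i : ℕ} (hε : 0 < ε)
    (hε4 : ε ≤ 1 / 4) (hi : 2 ≤ i) (hside : ∀ j, 0 < side j) (hprofit : ∀ j, 0 ≤ profit j)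
    (hgap : ∀ j, ε ^ (6 ^ (i - 1)) ≤ side j ∨ side j ≤ ε ^ (6 ^ i)) :
    Setting side profit (ε ^ (6 ^ (i - 1))) (ε ^ (6 ^ i)) (ε / 8) := by
  obtain ⟨m, rfl⟩ : ∃ m, i = m + 1 := ⟨i - 1, by omega⟩
  have hs : ε ^ (6 ^ (m + 1)) = (ε ^ (6 ^ m)) ^ 6 := by rw [pow_succ, pow_mul]
  simp only [Nat.add_sub_cancel] at hgap ⊢
  have htε : ε ^ (6 ^ m) ≤ ε := pow_le_of_le_one hε.le (by linarith) (by positivity)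
  have ht0 : 0 < ε ^ (6 ^ m) := by positivity
  rw [hs] at hgap ⊢
  set t := ε ^ (6 ^ m)
  have ht4 : t ^ 4 ≤ (1 / 4) ^ 4 := pow_le_pow_left₀ ht0.le (htε.trans hε4) 4
  have ht5 : t ^ 5 ≤ ε / 256 := by
    calc t ^ 5 = t * t ^ 4 := by ring
      _ ≤ ε * (1 / 4) ^ 4 := by gcongr
      _ = ε / 256 := by ring
  have ht6 : t ^ 6 = t ^ 5 * t := by ring
  -- `N ≥ 16 / ε` gives `2 / N ≤ ε / 8`; the windows fit because `s = t ^ 6` and `t ^ 5 ≤ ε / 256`.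
  refine ⟨hside, hprofit, hgap, by positivity, ?_, ⌈16 / ε⌉₊, by positivity, ?_, ?_⟩
  · rw [ht6]
    nlinarith
  · have hN : (⌈16 / ε⌉₊ : ℝ) ≤ 17 / ε := by
      have h₁ := (Nat.ceil_lt_add_one (by positivity : (0 : ℝ) ≤ 16 / ε)).le
      have h₂ : 1 ≤ 1 / ε := by rw [le_div_iff₀ hε]; linarith
      have h₃ : 17 / ε = 16 / ε + 1 / ε := by ring
      linarith
    calc (⌈16 / ε⌉₊ : ℝ) * (2 * t ^ 6) ≤ 17 / ε * (2 * t ^ 6) := by gcongr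
      _ = 34 / ε * t ^ 5 * t := by ring
      _ ≤ 34 / ε * (ε / 256) * t := by gcongr
      _ = 34 / 256 * t := by field_simp
      _ ≤ t := by linarith
  · rw [div_le_iff₀ (by positivity)]
    have := mul_le_mul_of_nonneg_left (Nat.le_ceil (16 / ε)) (by positivity : 0 ≤ ε / 8)
    have e : ε / 8 * (16 / ε) = 2 := by field_simp; norm_num
    linarith

end SquarePacking

theorem mainTheorem4 {n : ℕ} (h ε : ℝ) (i : ℕ) (side profit : Fin n → ℝ)
    (hh : 1 ≤ h) (hε : 0 < ε) (hεh : ε < (2 * h + 2 * h ^ 2)⁻¹) (hi : 2 ≤ i)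
    (hside : ∀ j, 0 < side j) (hprofit : ∀ j, 0 ≤ profit j)
    (hgap : ∀ j, ε ^ (6 ^ (i - 1)) ≤ side j ∨ side j ≤ ε ^ (6 ^ i))
    (Lopt : Finset (Fin n)) (hLopt : SquarePacking.IsOptimal h side profit Lopt)
    (hm : (Lopt.filter fun j => ε ^ (6 ^ (i - 1)) ≤ side j).card ≤ 4) :
    (1 - ε) * SquarePacking.opt h side profit ≤
      SquarePacking.cornerOpt h side profit (ε ^ (6 ^ (i - 1))) := by
  -- As `h ≥ 1`, the number `2 * h + 2 * h ^ 2` is at least 4.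
  have hε4 : ε ≤ 1 / 4 := by
    refine hεh.le.trans ?_
    rw [inv_eq_one_div]
    exact one_div_le_one_div_of_le (by norm_num) (by nlinarith)
  obtain ⟨⟨pos, hpos⟩, hopt⟩ := hLopt
  have hS := SquarePacking.setting_of_gap hε hε4 hi hside hprofit hgap
  obtain ⟨S', hS', pos', l, hp, hl, hlS, hlS', hc, hle⟩ :=
    hS.reach_of_card_le_four (B := SquarePacking.outside h)
      ((SquarePacking.isPacking_iff_packed hside).1 hpos) hm
      (fun _ _ => Or.inl ⟨rfl, le_rfl⟩) (fun _ _ => Or.inr (Or.inl ⟨rfl, le_rfl⟩))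
      (fun _ _ => Or.inr (Or.inr (Or.inl ⟨rfl, le_rfl⟩)))
      (fun _ _ => Or.inr (Or.inr (Or.inr ⟨rfl, le_rfl⟩)))
  have hlarge : SquarePacking.IsLargeCornerPacking h side (ε ^ (6 ^ (i - 1))) S' pos' :=
    ⟨(SquarePacking.isPacking_iff_packed hside).2 hp, l, hl,
      fun j => ⟨fun hj => ⟨hlS' j hj, ((hlS j).1 hj).2⟩, fun hj => (hlS j).2 ⟨hS' hj.1, hj.2⟩⟩,
      hc.isCornerSequence hside hp hl hlS'⟩
  refine le_trans ?_ (SquarePacking.totalProfit_le_cornerOpt hprofit hlarge)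
  rw [← hopt]
  unfold SquarePacking.totalProfit
  -- The loss is `8 * (ε / 8) = ε` times the optimal profit.
  push_cast at hle
  linarith
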